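/- For $f\in L_2(\mathbb{R}_+;x^{-1/2}dx)$ (complex-valued functions on $\mathbb{R}_+=(0,\infty)$ with norm $\left(\int_0^\infty|f(x)|^2x^{-1/2}dx\right)^{1/2}$) the half-Hilbert transform $$(H_+f)(x)=\frac1\pi\,\mathrm{PV}\!\int_0^\infty\frac{f(t)}{t-x}\,dt=\lim_{\varepsilon\to0+}\frac1\pi\int_{t>0,\ |t-x|>\varepsilon}\frac{f(t)}{t-x}\,dt$$ exists for almost all $x>0$, and $H_+$ is an isometric automorphism of $L_2(\mathbb{R}_+;x^{-1/2}dx)$, i.e. a linear bijection of this space onto itself with $\|H_+f\|=\|f\|$ for all $f$. Moreover, for every $f\in L_2(\mathbb{R}_+;x^{-1/2}dx)$, with $h=H_+f$, the reciprocal formulas $$h(x)=-\frac1\pi\frac{d}{dx}\int_0^\infty\log\left|1-\frac xt\right|f(t)\,dt,$$ $$f(x)=\frac1\pi\int_0^\infty\frac{h(t)}{\sqrt x+\sqrt t}\,\frac{dt}{\sqrt t}-(H_+h)(x)$$ hold for almost all $x>0$, where both integrals converge absolutely for every $x>0$ and the derivative exists for almost all $x>0$. -/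

import Mathlib

open MeasureTheory Filter Set
open scoped Topology

/-- The measure `x ^ a dx` on the half-axis `ℝ₊ = (0, ∞)`, as a measure on `ℝ`. -/
noncomputable def halfAxisMeasure (a : ℝ) : Measure ℝ :=
  (volume.restrict (Ioi (0 : ℝ))).withDensity (fun x => ENNReal.ofReal (x ^ a))

/-- The weighted space `L₂(ℝ₊; x ^ a dx)` of complex-valued functions. Its norm is
`(∫₀^∞ |f x|² x ^ a dx) ^ (1/2)`. -/
noncomputable abbrev HalfAxisL2 (a : ℝ) : Type :=
  Lp ℂ 2 (halfAxisMeasure a)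

/-- The integration domain left after removing the symmetric neighbourhood of `x` of radius `ε`
from the half-axis. -/
def truncatedHalfAxis (x ε : ℝ) : Set ℝ :=
  {t | 0 < t ∧ ε < |t - x|}

/-- `HasHalfHilbertAt f x y`: the principal value integral
`(1 / π) PV ∫₀^∞ f t / (t - x) dt` exists and equals `y`. All truncated integrals are required
to converge absolutely, and the principal value is their limit. -/
def HasHalfHilbertAt (f : ℝ → ℂ) (x : ℝ) (y : ℂ) : Prop :=
  (∀ ε : ℝ, 0 < ε → IntegrableOn (fun t : ℝ => f t / ((t - x : ℝ) : ℂ)) (truncatedHalfAxis x ε)) ∧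
  Tendsto
    (fun ε : ℝ => ((1 / Real.pi : ℝ) : ℂ) *
      ∫ t in truncatedHalfAxis x ε, f t / ((t - x : ℝ) : ℂ))
    (𝓝[>] (0 : ℝ)) (𝓝 y)

/-!
The substitution `x = s²` turns the weight `x ^ (-1/2) dx` on the half-axis into Lebesgue measure
on the line: `f ↦ (s ↦ f (s²))` is an isometry of the weighted space onto the even functions in
`L²(ℝ)`. Since `2 r / (r² - s²) = 1 / (r - s) + 1 / (r + s)`, the half-Hilbert transform of `f`
at `s²` is the Hilbert transform at `s` of the odd function `sgn r * f (r²)`. The Hilbert transform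
`hilbert` of the line is a unitary map whose square is `-1` and which exchanges odd and even
functions, so the half-Hilbert transform `halfHilbert` is an isometric automorphism.

The Hilbert transform itself is constructed as `-i` times the reflection in the closed span of the
Cauchy kernels `1 / (t - z)` with `Im z > 0`. Kernels with poles in opposite half-planes are
orthogonal, so `hilbert` multiplies each Cauchy kernel by `∓ i`. By unitarity the conjugate Poisson
integral of `G` is the Poisson integral of `hilbert G` (`integral_conjPoisson_mul`), and Poisson
integrals converge nontangentially at Lebesgue points. Taking Poisson integrals at `√(x + ε i)`
transfers this to the half-axis (`ae_tendsto_Ioi_conjPoisson`), and at a Lebesgue point the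
conjugate Poisson integral and the truncated integral differ by a quantity that tends to zero,
which gives the principal value (`ae_hasHalfHilbertAt`).

For the inversion formula (`ae_inversion`), `f (s²)` and the half-Hilbert transform of `h` at `s²`
add up to the Hilbert transform of a function supported on the negative half-axis, which for
`s > 0` is an ordinary integral. For the logarithmic formula, the inversion formula shows that the
inverse transform of `√x` on `(0, b]` is `-(√x / π) log |1 - b / x|`; pairing it with `f` gives
`∫ log |1 - b / t| f t dt = -π ∫_0^b h` (`integral_log_mul`), and Lebesgue's differentiation
theorem concludes.
-/

namespace HalfHilbert

open Metric
open scoped ENNReal ComplexConjugate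

/-! ### Poisson kernels at Lebesgue points -/

/-- The Poisson kernel `b / ((r - a)² + b²)`, the imaginary part of `1 / (r - (a + b i))`. It is
not divided by `π`, so that its integral is `π`. -/
noncomputable def poisson (a b r : ℝ) : ℝ := b / ((r - a) ^ 2 + b ^ 2)

/-- The conjugate Poisson kernel `(r - a) / ((r - a)² + b²)`, the real part of
`1 / (r - (a + b i))`. -/
noncomputable def conjPoisson (a b r : ℝ) : ℝ := (r - a) / ((r - a) ^ 2 + b ^ 2)

lemma den_pos {b : ℝ} (hb : 0 < b) (x : ℝ) : 0 < x ^ 2 + b ^ 2 := by positivity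

lemma poisson_nonneg {b : ℝ} (hb : 0 < b) (a r : ℝ) : 0 ≤ poisson a b r := by
  unfold poisson; positivity

@[fun_prop]
lemma continuous_poisson {b : ℝ} (hb : 0 < b) (a : ℝ) : Continuous (poisson a b) := by
  unfold poisson
  exact continuous_const.div (by fun_prop) fun r => (den_pos hb _).ne'

@[fun_prop]
lemma continuous_conjPoisson {b : ℝ} (hb : 0 < b) (a : ℝ) : Continuous (conjPoisson a b) := by
  unfold conjPoisson
  exact Continuous.div (by fun_prop) (by fun_prop) fun r => (den_pos hb _).ne'

lemma poisson_eq_cauchyPDFReal {b : ℝ} (hb : 0 < b) (a : ℝ) :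
    poisson a b = fun r => Real.pi * ProbabilityTheory.cauchyPDFReal a ⟨b, hb.le⟩ r := by
  ext r
  have := den_pos hb (r - a)
  rw [poisson, ProbabilityTheory.cauchyPDFReal_def a ⟨b, hb.le⟩ r]
  change _ = Real.pi * (Real.pi⁻¹ * b * ((r - a) ^ 2 + b ^ 2)⁻¹)
  have hpi := Real.pi_ne_zero
  field_simp

lemma integrable_poisson {b : ℝ} (hb : 0 < b) (a : ℝ) : Integrable (poisson a b) := by
  rw [poisson_eq_cauchyPDFReal hb]
  exact (ProbabilityTheory.integrable_cauchyPDFReal a).const_mul _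

lemma integrable_poisson_mul_const {b : ℝ} (hb : 0 < b) (a : ℝ) (c : ℂ) :
    Integrable fun r => (poisson a b r : ℂ) * c :=
  (integrable_poisson hb a).ofReal.mul_const c

lemma integral_poisson {b : ℝ} (hb : 0 < b) (a : ℝ) : ∫ r, poisson a b r = Real.pi := by
  have hb' : (⟨b, hb.le⟩ : NNReal) ≠ 0 := fun h => hb.ne' (congrArg NNReal.toReal h)
  rw [poisson_eq_cauchyPDFReal hb, integral_const_mul,
    ProbabilityTheory.integral_cauchyPDFReal_eq_one a hb', mul_one]

/-- `s` is a Lebesgue point of `f`: the mean oscillation of `f` about `f s` over the intervals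
centred at `s` tends to zero. -/
def IsLebesguePoint (f : ℝ → ℂ) (s : ℝ) : Prop :=
  Tendsto (fun δ => ⨍ r in closedBall s δ, ‖f r - f s‖) (𝓝[>] 0) (𝓝 0)

lemma ae_isLebesguePoint {f : ℝ → ℂ} (hf : LocallyIntegrable f) : ∀ᵐ s, IsLebesguePoint f s := by
  filter_upwards [IsUnifLocDoublingMeasure.ae_tendsto_average_norm_sub volume hf 1] with s hs
  refine hs (fun _ => s) id tendsto_id ?_
  filter_upwards [self_mem_nhdsWithin] with δ hδ
  simpa using (mem_Ioi.1 hδ).le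

/-- The Poisson kernel is dominated by a sum of normalised indicators of dyadic intervals. -/
lemma poisson_le_tsum {δ : ℝ} (hδ : 0 < δ) (s r : ℝ) :
    ENNReal.ofReal (poisson s δ r) ≤ ∑' k : ℕ, ENNReal.ofReal (4 * (1 / 4) ^ k / δ) *
      (closedBall s (2 ^ k * δ)).indicator 1 r := by
  have hex : ∃ k : ℕ, |r - s| ≤ 2 ^ k * δ := by
    obtain ⟨k, hk⟩ := pow_unbounded_of_one_lt (|r - s| / δ) (one_lt_two)
    exact ⟨k, by rw [div_lt_iff₀ hδ] at hk; exact hk.le⟩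
  classical
  set k := Nat.find hex with hk
  have hkr : |r - s| ≤ 2 ^ k * δ := Nat.find_spec hex
  refine le_trans ?_ (ENNReal.le_tsum k)
  rw [indicator_of_mem (by simpa [Real.dist_eq] using hkr), Pi.one_apply, mul_one]
  apply ENNReal.ofReal_le_ofReal
  unfold poisson
  rw [div_le_div_iff₀ (den_pos hδ _) hδ]
  rcases Nat.eq_zero_or_pos k with h0 | hpos
  · rw [h0]; nlinarith [sq_nonneg (r - s)]
  · obtain ⟨j, hj⟩ := Nat.exists_eq_succ_of_ne_zero hpos.ne'
    have hlt : 2 ^ j * δ < |r - s| := by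
      have := Nat.find_min hex (m := j) (by omega)
      exact not_le.1 this
    have h1 : (2 ^ j * δ) ^ 2 ≤ (r - s) ^ 2 := by
      rw [← sq_abs (r - s)]; gcongr
    rw [hj, pow_succ]
    have h4 : ((1 : ℝ) / 4) ^ j * (2 ^ j) ^ 2 = 1 := by
      rw [← pow_mul, mul_comm j 2, pow_mul, ← mul_pow]; norm_num
    have h5 : 0 < ((1 : ℝ) / 4) ^ j := by positivity
    calc δ * δ = ((1 : ℝ) / 4) ^ j * (2 ^ j) ^ 2 * δ ^ 2 := by rw [h4]; ring
      _ = ((1 : ℝ) / 4) ^ j * (2 ^ j * δ) ^ 2 := by ring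
      _ ≤ ((1 : ℝ) / 4) ^ j * ((r - s) ^ 2 + δ ^ 2) := by gcongr; nlinarith [sq_nonneg δ]
      _ = _ := by ring

/-- If the mean of `φ` over every interval centred at `s` is bounded, then so are its Poisson
integrals at `s`. -/
lemma lintegral_mul_poisson_le {φ : ℝ → ℝ≥0∞} (hφ : AEMeasurable φ) {C : ℝ≥0∞} {s : ℝ}
    (h : ∀ R : ℝ, 0 < R → ∫⁻ r in closedBall s R, φ r ≤ C * ENNReal.ofReal R)
    {δ : ℝ} (hδ : 0 < δ) :
    ∫⁻ r, φ r * ENNReal.ofReal (poisson s δ r) ≤ 8 * C := by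
  have hterm (k : ℕ) : ∫⁻ r, φ r * (ENNReal.ofReal (4 * (1 / 4) ^ k / δ) *
      (closedBall s (2 ^ k * δ)).indicator 1 r) ≤ C * (4 * ENNReal.ofReal ((1 / 2) ^ k)) := by
    have h1 : ∀ r, φ r * (ENNReal.ofReal (4 * (1 / 4) ^ k / δ) *
        (closedBall s (2 ^ k * δ)).indicator 1 r) = ENNReal.ofReal (4 * (1 / 4) ^ k / δ) *
        (closedBall s (2 ^ k * δ)).indicator φ r := by
      intro r
      by_cases hr : r ∈ closedBall s (2 ^ k * δ)
      · simp only [indicator_of_mem hr, Pi.one_apply]; ring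
      · simp only [indicator_of_notMem hr, mul_zero]
    simp_rw [h1]
    rw [lintegral_const_mul' _ _ ENNReal.ofReal_ne_top,
      lintegral_indicator measurableSet_closedBall]
    calc _ ≤ ENNReal.ofReal (4 * (1 / 4) ^ k / δ) * (C * ENNReal.ofReal (2 ^ k * δ)) := by
          gcongr; exact h _ (by positivity)
      _ = C * (ENNReal.ofReal (4 * (1 / 4) ^ k / δ) * ENNReal.ofReal (2 ^ k * δ)) := by ring
      _ = _ := by
        rw [← ENNReal.ofReal_mul (by positivity)]
        have h2 : (4 : ℝ≥0∞) = ENNReal.ofReal 4 := by simp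
        rw [h2, ← ENNReal.ofReal_mul (by norm_num)]
        congr 2
        have h4 : ((1 : ℝ) / 4) ^ k * 2 ^ k = (1 / 2) ^ k := by rw [← mul_pow]; norm_num
        rw [← h4]; field_simp
  calc _ ≤ ∫⁻ r, φ r * ∑' k : ℕ, ENNReal.ofReal (4 * (1 / 4) ^ k / δ) *
      (closedBall s (2 ^ k * δ)).indicator 1 r := by
        gcongr with r; exact poisson_le_tsum hδ s r
    _ = ∑' k : ℕ, ∫⁻ r, φ r * (ENNReal.ofReal (4 * (1 / 4) ^ k / δ) *
      (closedBall s (2 ^ k * δ)).indicator 1 r) := by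
        simp_rw [← ENNReal.tsum_mul_left]
        refine lintegral_tsum fun k => hφ.mul ?_
        exact (measurable_const.mul
          (measurable_one.indicator measurableSet_closedBall)).aemeasurable
    _ ≤ ∑' k : ℕ, C * (4 * ENNReal.ofReal ((1 / 2) ^ k)) := ENNReal.tsum_le_tsum hterm
    _ = 8 * C := by
        rw [ENNReal.tsum_mul_left, ENNReal.tsum_mul_left,
          ← ENNReal.ofReal_tsum_of_nonneg (fun k => by positivity) summable_geometric_two,
          tsum_geometric_two]
        rw [show (4 : ℝ≥0∞) * ENNReal.ofReal 2 = 8 by simp; norm_num]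
        ring

lemma integrable_poisson_mul_sub {f : ℝ → ℂ} {s a b : ℝ} (hb : 0 < b)
    (hint : Integrable fun r => (poisson a b r : ℂ) * f r) :
    Integrable fun r => (poisson a b r : ℂ) * (f r - f s) := by
  simp_rw [mul_sub]
  exact hint.sub (integrable_poisson_mul_const hb a _)

/-- At a Lebesgue point the oscillation of `f`, averaged against the Poisson kernel, vanishes in
the limit. -/
lemma IsLebesguePoint.tendsto_lintegral {f : ℝ → ℂ} {s : ℝ} (h : IsLebesguePoint f s)
    (hf : LocallyIntegrable f) (hint : Integrable fun r => (poisson s 1 r : ℂ) * f r) :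
    Tendsto (fun δ => ∫⁻ r, ‖f r - f s‖ₑ * ENNReal.ofReal (poisson s δ r)) (𝓝[>] 0) (𝓝 0) := by
  set φ : ℝ → ℝ≥0∞ := fun r => ‖f r - f s‖ₑ with hφdef
  have hloc : LocallyIntegrable fun r => f r - f s := hf.sub (locallyIntegrable_const _)
  have hφ : AEMeasurable φ := hloc.aestronglyMeasurable.enorm
  have hI : ∫⁻ r, φ r * ENNReal.ofReal (poisson s 1 r) ≠ ∞ := by
    have := (integrable_poisson_mul_sub (s := s) one_pos hint).hasFiniteIntegral
    refine ne_of_lt (lt_of_eq_of_lt ?_ this)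
    refine lintegral_congr fun r => ?_
    rw [enorm_mul, mul_comm, ← Real.enorm_of_nonneg (poisson_nonneg one_pos s r)]
    congr 1
    simp [← ofReal_norm]
  rw [ENNReal.tendsto_nhds_zero]
  intro ε hε
  obtain ⟨η, hη0, hη⟩ := ENNReal.lt_iff_exists_nnreal_btwn.1 (ENNReal.half_pos hε.ne')
  have hη0' : 0 < (η : ℝ) := by exact_mod_cast hη0
  have hev := (h.eventually (gt_mem_nhds (show (0 : ℝ) < η / 16 by positivity)))
  obtain ⟨ρ, hρ, hρs⟩ := mem_nhdsGT_iff_exists_Ioc_subset.1 hev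
  rw [mem_Ioi] at hρ
  have hsmall (R : ℝ) (hR : 0 < R) (hRρ : R ≤ ρ) :
      ∫⁻ r in closedBall s R, φ r ≤ ENNReal.ofReal (η / 8) * ENNReal.ofReal R := by
    have h1 : ⨍ r in closedBall s R, ‖f r - f s‖ < η / 16 := hρs ⟨hR, hRρ⟩
    have hin : IntegrableOn (fun r => f r - f s) (closedBall s R) :=
      hloc.integrableOn_isCompact (isCompact_closedBall s R)
    rw [setAverage_eq, smul_eq_mul, Measure.real, Real.volume_closedBall,
      ENNReal.toReal_ofReal (by positivity), inv_mul_lt_iff₀ (by positivity)] at h1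
    rw [← ofReal_integral_norm_eq_lintegral_enorm hin, ← ENNReal.ofReal_mul (by positivity)]
    apply ENNReal.ofReal_le_ofReal
    linarith
  -- on `closedBall s ρ` the means are small at every scale after cutting off; outside it the
  -- kernel is at most `δ (1 + 1 / ρ²)` times the kernel with `δ = 1`
  have hnear (δ : ℝ) (hδ : 0 < δ) :
      ∫⁻ r in closedBall s ρ, φ r * ENNReal.ofReal (poisson s δ r) ≤ ε / 2 := by
    have h1 := lintegral_mul_poisson_le (φ := (closedBall s ρ).indicator φ)
      (hφ.indicator measurableSet_closedBall) (C := ENNReal.ofReal (η / 8)) (s := s) (by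
        intro R hR
        rw [lintegral_indicator measurableSet_closedBall,
          Measure.restrict_restrict measurableSet_closedBall]
        rcases le_total R ρ with hle | hle
        · exact (lintegral_mono_set inter_subset_right).trans (hsmall R hR hle)
        · refine (lintegral_mono_set inter_subset_left).trans ((hsmall ρ hρ le_rfl).trans ?_)
          gcongr) hδ
    rw [← lintegral_indicator measurableSet_closedBall]
    simp_rw [indicator_mul_left]
    refine h1.trans ?_
    rw [show (8 : ℝ≥0∞) = ENNReal.ofReal 8 by simp, ← ENNReal.ofReal_mul (by norm_num),
      show (8 : ℝ) * (η / 8) = η by ring, ENNReal.ofReal_coe_nnreal]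
    exact hη.le
  have hfar (δ : ℝ) (hδ : 0 < δ) :
      ∫⁻ r in (closedBall s ρ)ᶜ, φ r * ENNReal.ofReal (poisson s δ r) ≤
        ENNReal.ofReal (δ * (1 + 1 / ρ ^ 2)) * ∫⁻ r, φ r * ENNReal.ofReal (poisson s 1 r) := by
    rw [← lintegral_const_mul' _ _ ENNReal.ofReal_ne_top]
    refine (setLIntegral_mono' measurableSet_closedBall.compl fun r hr => ?_).trans
      (setLIntegral_le_lintegral _ _)
    have hr' : ρ < |r - s| := by simpa [Real.dist_eq] using hr
    rw [mul_left_comm, ← ENNReal.ofReal_mul (by positivity)]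
    gcongr
    unfold poisson
    have h2 : ρ ^ 2 ≤ (r - s) ^ 2 := by rw [← sq_abs (r - s)]; gcongr
    have h3 : 1 ≤ 1 / ρ ^ 2 * (r - s) ^ 2 := by
      rw [one_div_mul_eq_div, one_le_div (by positivity)]; exact h2
    rw [mul_one_div, div_le_div_iff₀ (den_pos hδ _) (den_pos one_pos _)]
    have h4 : (r - s) ^ 2 + 1 ^ 2 ≤ (1 + 1 / ρ ^ 2) * ((r - s) ^ 2 + δ ^ 2) := by
      have : 0 ≤ (1 + 1 / ρ ^ 2) * δ ^ 2 := by positivity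
      nlinarith
    nlinarith
  have hlim : Tendsto (fun δ : ℝ => ENNReal.ofReal (δ * (1 + 1 / ρ ^ 2)) *
      ∫⁻ r, φ r * ENNReal.ofReal (poisson s 1 r)) (𝓝[>] 0) (𝓝 0) := by
    have h1 : Tendsto (fun δ : ℝ => δ * (1 + 1 / ρ ^ 2)) (𝓝[>] 0) (𝓝 (0 * (1 + 1 / ρ ^ 2))) :=
      ((continuous_id.mul continuous_const).tendsto 0).mono_left nhdsWithin_le_nhds
    rw [zero_mul] at h1
    have h2 := ENNReal.Tendsto.mul_const (b := ∫⁻ r, φ r * ENNReal.ofReal (poisson s 1 r))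
      (ENNReal.tendsto_ofReal h1) (Or.inr hI)
    simpa using h2
  filter_upwards [ENNReal.tendsto_nhds_zero.1 hlim (ε / 2) (ENNReal.half_pos hε.ne'),
    self_mem_nhdsWithin] with δ hδ hδ0
  rw [← lintegral_add_compl _ (measurableSet_closedBall (x := s) (ε := ρ))]
  calc _ ≤ ε / 2 + ε / 2 := add_le_add (hnear δ hδ0) ((hfar δ hδ0).trans hδ)
    _ = ε := ENNReal.add_halves ε

/-- Nontangential convergence of Poisson integrals at Lebesgue points. -/
lemma IsLebesguePoint.tendsto_poisson {f : ℝ → ℂ} {s : ℝ} (h : IsLebesguePoint f s)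
    (hf : LocallyIntegrable f)
    (hint : ∀ a b : ℝ, 0 < b → Integrable fun r => (poisson a b r : ℂ) * f r)
    {ι : Type*} {l : Filter ι} {a b : ι → ℝ} (hb : Tendsto b l (𝓝[>] 0))
    (hab : ∀ᶠ i in l, |a i - s| ≤ b i) :
    Tendsto (fun i => ∫ r, (poisson (a i) (b i) r : ℂ) * f r) l (𝓝 (Real.pi * f s)) := by
  rw [tendsto_iff_edist_tendsto_0]
  have hlim := (h.tendsto_lintegral hf (hint s 1 one_pos)).comp hb
  have hlim3 := ENNReal.Tendsto.const_mul (a := 3) hlim (Or.inr (by norm_num))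
  rw [mul_zero] at hlim3
  refine tendsto_of_tendsto_of_tendsto_of_le_of_le' tendsto_const_nhds hlim3
    (Eventually.of_forall fun _ => zero_le) ?_
  filter_upwards [hab, hb.eventually self_mem_nhdsWithin] with i hi hbi
  replace hbi : 0 < b i := hbi
  have h1 : (∫ r, (poisson (a i) (b i) r : ℂ) * f r) - Real.pi * f s =
      ∫ r, (poisson (a i) (b i) r : ℂ) * (f r - f s) := by
    simp_rw [mul_sub]
    rw [integral_sub (hint _ _ hbi) (integrable_poisson_mul_const hbi _ _),
      integral_mul_const, integral_complex_ofReal, integral_poisson hbi]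
  rw [edist_eq_enorm_sub, h1]
  refine (enorm_integral_le_lintegral_enorm _).trans ?_
  rw [Function.comp_apply, ← lintegral_const_mul' _ _ (by norm_num)]
  refine lintegral_mono fun r => ?_
  rw [enorm_mul, mul_comm, mul_left_comm]
  gcongr
  rw [show (3 : ℝ≥0∞) = ENNReal.ofReal 3 by simp, ← ENNReal.ofReal_mul (by norm_num),
    ← ofReal_norm, Complex.norm_real, Real.norm_of_nonneg (poisson_nonneg hbi _ _)]
  apply ENNReal.ofReal_le_ofReal
  unfold poisson
  rw [mul_div_assoc', div_le_div_iff₀ (den_pos hbi _) (den_pos hbi _)]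
  have h2 : (a i - s) ^ 2 ≤ b i ^ 2 := by rw [← sq_abs (a i - s)]; gcongr
  nlinarith [sq_nonneg ((r - a i) - (a i - s)), sq_nonneg (b i)]

/-- The kernel of the Hilbert transform truncated at distance `ε` from `x`. -/
noncomputable def truncKernel (x ε : ℝ) : ℝ → ℝ :=
  {t | ε < |t - x|}.indicator fun t => 1 / (t - x)

lemma measurableSet_trunc (x ε : ℝ) : MeasurableSet {t : ℝ | ε < |t - x|} :=
  measurableSet_lt measurable_const (by fun_prop)

lemma abs_conjPoisson_sub_truncKernel_le {ε : ℝ} (hε : 0 < ε) (x t : ℝ) :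
    |conjPoisson x ε t - truncKernel x ε t| ≤ poisson x ε t := by
  have hd := den_pos hε (t - x)
  by_cases ht : ε < |t - x|
  · rw [truncKernel, indicator_of_mem (by exact ht)]
    have h0 : t - x ≠ 0 := fun h => by rw [h, abs_zero] at ht; linarith
    have h1 : conjPoisson x ε t - 1 / (t - x) = -(ε / (t - x)) * (poisson x ε t) := by
      unfold conjPoisson poisson; field_simp; ring
    rw [h1, abs_mul, abs_neg, abs_div, abs_of_pos hε, abs_of_nonneg (poisson_nonneg hε x t)]
    exact mul_le_of_le_one_left (poisson_nonneg hε x t) ((div_le_one (hε.trans ht)).2 ht.le)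
  · rw [truncKernel, indicator_of_notMem (by exact ht), sub_zero, conjPoisson, poisson, abs_div,
      abs_of_pos hd]
    gcongr
    exact not_lt.1 ht

lemma integral_conjPoisson_sub_truncKernel {ε : ℝ} (x : ℝ) :
    ∫ t, (conjPoisson x ε t - truncKernel x ε t) = 0 := by
  have h := integral_sub_left_eq_self (fun t => conjPoisson x ε t - truncKernel x ε t)
    volume (2 * x)
  have h2 : ∀ t, conjPoisson x ε (2 * x - t) - truncKernel x ε (2 * x - t) =
      -(conjPoisson x ε t - truncKernel x ε t) := by
    intro t
    have e : 2 * x - t - x = -(t - x) := by ring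
    have h3 : conjPoisson x ε (2 * x - t) = - conjPoisson x ε t := by
      unfold conjPoisson; rw [e, neg_sq, neg_div]
    have h4 : truncKernel x ε (2 * x - t) = - truncKernel x ε t := by
      by_cases ht : ε < |t - x|
      · rw [truncKernel, indicator_of_mem (by simpa only [mem_ofPred_eq, e, abs_neg] using ht),
          indicator_of_mem (by exact ht), e, div_neg]
      · rw [truncKernel, indicator_of_notMem (by simpa only [mem_ofPred_eq, e, abs_neg] using ht),
          indicator_of_notMem (by exact ht), neg_zero]
    rw [h3, h4]; ring
  simp_rw [h2] at h
  rw [integral_neg] at h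
  linarith

/-- At a Lebesgue point, principal value truncation and conjugate Poisson regularisation of the
Hilbert transform are equivalent. -/
lemma IsLebesguePoint.tendsto_conjPoisson_sub_truncKernel {f : ℝ → ℂ} {x : ℝ}
    (h : IsLebesguePoint f x) (hf : LocallyIntegrable f)
    (hint : ∀ b : ℝ, 0 < b → Integrable fun r => (poisson x b r : ℂ) * f r)
    (hq : ∀ b : ℝ, 0 < b → Integrable fun r => (conjPoisson x b r : ℂ) * f r)
    (ht : ∀ b : ℝ, 0 < b → Integrable fun r => (truncKernel x b r : ℂ) * f r) :
    Tendsto (fun ε => (∫ r, (conjPoisson x ε r : ℂ) * f r) - ∫ r, (truncKernel x ε r : ℂ) * f r)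
      (𝓝[>] 0) (𝓝 0) := by
  rw [tendsto_iff_edist_tendsto_0]
  refine tendsto_of_tendsto_of_tendsto_of_le_of_le' tendsto_const_nhds
    (h.tendsto_lintegral hf (hint 1 one_pos)) (Eventually.of_forall fun _ => zero_le) ?_
  filter_upwards [self_mem_nhdsWithin] with ε hε
  replace hε : 0 < ε := hε
  have hD : Integrable fun r => conjPoisson x ε r - truncKernel x ε r := by
    refine (integrable_poisson hε x).mono' ?_ (ae_of_all _ fun r => ?_)
    · refine ((continuous_conjPoisson hε x).measurable.sub ?_).aestronglyMeasurable
      exact Measurable.indicator (by fun_prop) (measurableSet_trunc x ε)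
    · exact abs_conjPoisson_sub_truncKernel_le hε x r
  have h1 : (∫ r, (conjPoisson x ε r : ℂ) * f r) - ∫ r, (truncKernel x ε r : ℂ) * f r =
      ∫ r, ((conjPoisson x ε r - truncKernel x ε r : ℝ) : ℂ) * (f r - f x) := by
    have h0 : ∫ r, ((conjPoisson x ε r - truncKernel x ε r : ℝ) : ℂ) * f x = 0 := by
      rw [integral_mul_const, integral_complex_ofReal, integral_conjPoisson_sub_truncKernel,
        Complex.ofReal_zero, zero_mul]
    have h2 : Integrable fun r => ((conjPoisson x ε r - truncKernel x ε r : ℝ) : ℂ) * f r := by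
      simp only [Complex.ofReal_sub, sub_mul]
      exact (hq ε hε).sub (ht ε hε)
    have h3 : Integrable fun r => ((conjPoisson x ε r - truncKernel x ε r : ℝ) : ℂ) * f x :=
      hD.ofReal.mul_const _
    simp_rw [mul_sub]
    rw [integral_sub h2 h3, h0, sub_zero,
      ← integral_sub (hq ε hε) (ht ε hε)]
    simp only [Complex.ofReal_sub, sub_mul]
  rw [edist_zero_right, h1]
  refine (enorm_integral_le_lintegral_enorm _).trans (lintegral_mono fun r => ?_)
  rw [enorm_mul, mul_comm]
  gcongr
  rw [← ofReal_norm, Complex.norm_real, Real.norm_eq_abs]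
  exact ENNReal.ofReal_le_ofReal (abs_conjPoisson_sub_truncKernel_le hε x r)

/-! ### The Hilbert transform on the line -/

/-- The Cauchy kernel `1 / (t - z)` as a function of real `t`. -/
noncomputable def cauchyKernel (z : ℂ) (t : ℝ) : ℂ := ((t : ℂ) - z)⁻¹

lemma ofReal_sub_ne_zero {z : ℂ} (hz : z.im ≠ 0) (t : ℝ) : (t : ℂ) - z ≠ 0 := by
  intro h
  apply hz
  have := congrArg Complex.im h
  simpa using this

lemma continuous_cauchyKernel {z : ℂ} (hz : z.im ≠ 0) : Continuous (cauchyKernel z) :=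
  Continuous.inv₀ (by fun_prop) (ofReal_sub_ne_zero hz)

lemma cauchyKernel_eq (z : ℂ) (t : ℝ) :
    cauchyKernel z t = conjPoisson z.re z.im t + Complex.I * poisson z.re z.im t := by
  have hn : Complex.normSq ((t : ℂ) - z) = (t - z.re) ^ 2 + z.im ^ 2 := by
    simp [Complex.normSq_apply]; ring
  apply Complex.ext
  · rw [cauchyKernel, Complex.inv_re, hn]
    simp only [conjPoisson, Complex.add_re, Complex.ofReal_re, Complex.mul_re, Complex.I_re,
      Complex.I_im, Complex.ofReal_im, Complex.sub_re]
    ring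
  · rw [cauchyKernel, Complex.inv_im, hn]
    simp only [poisson, Complex.add_im, Complex.ofReal_re, Complex.mul_im, Complex.I_re,
      Complex.I_im, Complex.ofReal_im, Complex.sub_im]
    ring

lemma conj_cauchyKernel (z : ℂ) (t : ℝ) : conj (cauchyKernel z t) = cauchyKernel (conj z) t := by
  simp [cauchyKernel]

lemma norm_sq_cauchyKernel {z : ℂ} (hz : z.im ≠ 0) (t : ℝ) :
    ‖cauchyKernel z t‖ ^ 2 = |z.im|⁻¹ * poisson z.re |z.im| t := by
  have h : 0 < |z.im| := abs_pos.2 hz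
  have hn : Complex.normSq ((t : ℂ) - z) = (t - z.re) ^ 2 + z.im ^ 2 := by
    simp [Complex.normSq_apply]; ring
  rw [cauchyKernel, norm_inv, inv_pow, ← Complex.normSq_eq_norm_sq, hn, poisson, sq_abs]
  field_simp

lemma memLp_cauchyKernel {z : ℂ} (hz : z.im ≠ 0) : MemLp (cauchyKernel z) 2 := by
  rw [memLp_two_iff_integrable_sq_norm (continuous_cauchyKernel hz).aestronglyMeasurable]
  simp_rw [norm_sq_cauchyKernel hz]
  exact (integrable_poisson (abs_pos.2 hz) _).const_mul _

lemma tendsto_cauchyKernel (z : ℂ) {l : Filter ℝ}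
    (hl : Tendsto (fun t : ℝ => |t|) l atTop) :
    Tendsto (cauchyKernel z) l (𝓝 0) := by
  refine tendsto_inv₀_cobounded.comp ?_
  rw [← tendsto_norm_atTop_iff_cobounded]
  refine tendsto_atTop_mono (fun t => ?_) (tendsto_atTop_add_const_right _ (-‖z‖) hl)
  have := norm_sub_norm_le (t : ℂ) z
  rw [Complex.norm_real, Real.norm_eq_abs] at this
  linarith

/-- Cauchy kernels with poles in the same half-plane have product of integral zero. -/
lemma integral_cauchyKernel_mul {z w : ℂ} (h : 0 < z.im * w.im) :
    ∫ t, cauchyKernel z t * cauchyKernel w t = 0 := by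
  have hz : z.im ≠ 0 := left_ne_zero_of_mul h.ne'
  have hw : w.im ≠ 0 := right_ne_zero_of_mul h.ne'
  have hint : Integrable fun t => cauchyKernel z t * cauchyKernel w t :=
    (memLp_cauchyKernel hz).integrable_mul (memLp_cauchyKernel hw)
  have hd (u : ℂ) (t : ℝ) : HasDerivAt (fun t : ℝ => (t : ℂ) - u) 1 t :=
    ((hasDerivAt_id t).ofReal_comp).sub_const u
  by_cases hzw : z = w
  · subst hzw
    have hder (t : ℝ) : HasDerivAt (fun t => -cauchyKernel z t)
        (cauchyKernel z t * cauchyKernel z t) t := by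
      have h0 := ofReal_sub_ne_zero hz t
      refine ((hd z t).inv h0).neg.congr_deriv ?_
      simp only [cauchyKernel]; field_simp
    have hlim {l : Filter ℝ} (hl : Tendsto (fun t : ℝ => |t|) l atTop) :
        Tendsto (fun t => -cauchyKernel z t) l (𝓝 0) := by
      simpa using (tendsto_cauchyKernel z hl).neg
    rw [integral_of_hasDerivAt_of_tendsto hder hint (hlim tendsto_abs_atBot_atTop)
      (hlim tendsto_abs_atTop_atTop), sub_zero]
  · -- `log ((t - z) / (t - w))` is a global primitive: the quotient never meets `(-∞, 0]`,
    -- as the imaginary parts of `t - z` and `t - w` have the same sign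
    have hslit (t : ℝ) : ((t : ℂ) - z) / (t - w) ∈ Complex.slitPlane := by
      by_contra hns
      rw [Complex.mem_slitPlane_iff_not_le_zero, not_not, Complex.le_def] at hns
      simp only [Complex.zero_re, Complex.zero_im] at hns
      set u := ((t : ℂ) - z) / (t - w) with hu
      have h1 : (t : ℂ) - z = u * (t - w) := by
        rw [hu, div_mul_cancel₀ _ (ofReal_sub_ne_zero hw t)]
      have h2 := congrArg Complex.im h1
      simp only [Complex.sub_im, Complex.ofReal_im, Complex.mul_im, hns.2, zero_mul, add_zero,
        zero_sub, Complex.sub_re] at h2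
      have h3 : z.im = u.re * w.im := by linarith
      rw [h3, mul_assoc] at h
      exact absurd h (not_lt.2 (mul_nonpos_of_nonpos_of_nonneg hns.1 (mul_self_nonneg _)))
    have hder (t : ℝ) : HasDerivAt (fun t : ℝ => (z - w)⁻¹ * Complex.log (((t : ℂ) - z) / (t - w)))
        (cauchyKernel z t * cauchyKernel w t) t := by
      have h0 := ofReal_sub_ne_zero hz t
      have h1 := ofReal_sub_ne_zero hw t
      have h2 := sub_ne_zero.2 hzw
      refine ((((hd z t).div (hd w t) h1).clog_real (hslit t)).const_mul (z - w)⁻¹).congr_deriv ?_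
      simp only [cauchyKernel, Pi.div_apply]
      field_simp
      ring
    have hlim {l : Filter ℝ} (hl : Tendsto (fun t : ℝ => |t|) l atTop) :
        Tendsto (fun t : ℝ => (z - w)⁻¹ * Complex.log (((t : ℂ) - z) / (t - w))) l (𝓝 0) := by
      have h1 : Tendsto (fun t : ℝ => ((t : ℂ) - z) / (t - w)) l (𝓝 1) := by
        have h2 := ((tendsto_cauchyKernel w hl).const_mul (w - z)).const_add 1
        rw [mul_zero, add_zero] at h2
        refine h2.congr fun t => ?_
        have h3 := ofReal_sub_ne_zero hw t
        simp only [cauchyKernel]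
        field_simp
        ring
      have h4 := (h1.clog (by simp)).const_mul (z - w)⁻¹
      simpa using h4
    rw [integral_of_hasDerivAt_of_tendsto hder hint (hlim tendsto_abs_atBot_atTop)
      (hlim tendsto_abs_atTop_atTop), sub_zero]

/-- The space of complex-valued square integrable functions on the line. -/
abbrev LineL2 : Type := Lp ℂ 2 (volume : Measure ℝ)

/-- The Cauchy kernel as an element of `L²`. -/
noncomputable def cauchyLp {z : ℂ} (hz : z.im ≠ 0) : LineL2 := (memLp_cauchyKernel hz).toLp _

lemma inner_cauchyLp {z : ℂ} (hz : z.im ≠ 0) (G : LineL2) :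
    inner ℂ (cauchyLp hz) G = ∫ t, cauchyKernel (conj z) t * G t := by
  rw [L2.inner_def]
  refine integral_congr_ae ?_
  filter_upwards [(memLp_cauchyKernel hz).coeFn_toLp] with t ht
  rw [cauchyLp, ht, RCLike.inner_apply, conj_cauchyKernel, mul_comm]

lemma inner_cauchyLp_cauchyLp {z w : ℂ} (hz : 0 < z.im) (hw : w.im < 0) :
    inner ℂ (cauchyLp hz.ne') (cauchyLp hw.ne) = 0 := by
  rw [inner_cauchyLp, ← integral_cauchyKernel_mul (z := conj z) (w := w)]
  · refine integral_congr_ae ?_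
    filter_upwards [(memLp_cauchyKernel hw.ne).coeFn_toLp] with t ht
    rw [cauchyLp, ht]
  · rw [Complex.conj_im]; nlinarith

/-- The closed span of the Cauchy kernels with pole in the upper half-plane: the boundary values
of the Hardy space of the lower half-plane. -/
noncomputable def hardySpace : Submodule ℂ LineL2 :=
  (Submodule.span ℂ {v | ∃ (z : ℂ) (hz : 0 < z.im), v = cauchyLp hz.ne'}).topologicalClosure

noncomputable instance : CompleteSpace hardySpace :=
  Submodule.topologicalClosure.completeSpace _

lemma cauchyLp_mem_hardySpace {z : ℂ} (hz : 0 < z.im) : cauchyLp hz.ne' ∈ hardySpace :=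
  Submodule.le_topologicalClosure _ (Submodule.subset_span ⟨z, hz, rfl⟩)

lemma cauchyLp_mem_hardySpace_orthogonal {w : ℂ} (hw : w.im < 0) :
    cauchyLp hw.ne ∈ hardySpaceᗮ := by
  rw [hardySpace, Submodule.orthogonal_closure, Submodule.mem_orthogonal]
  intro u hu
  induction hu using Submodule.span_induction with
  | mem x hx => obtain ⟨z, hz, rfl⟩ := hx; exact inner_cauchyLp_cauchyLp hz hw
  | zero => exact inner_zero_left _
  | add x y _ _ hx hy => rw [inner_add_left, hx, hy, add_zero]
  | smul c x _ hx => rw [inner_smul_left, hx, mul_zero]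

/-- The Hilbert transform on the line, with the sign convention `(1 / π) PV ∫ G t / (t - s) dt`.
It is defined as `-i` times the reflection in the Hardy space of the lower half-plane. -/
noncomputable def hilbert : LineL2 →ₗᵢ[ℂ] LineL2 where
  toLinearMap := (-Complex.I) • (hardySpace.reflection.toLinearEquiv : LineL2 →ₗ[ℂ] LineL2)
  norm_map' G := by simp [norm_smul]

lemma hilbert_apply (G : LineL2) : hilbert G = (-Complex.I) • hardySpace.reflection G := rfl

lemma hilbert_hilbert (G : LineL2) : hilbert (hilbert G) = -G := by
  rw [hilbert_apply, hilbert_apply, map_smul, Submodule.reflection_reflection, smul_smul]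
  simp

lemma hilbert_cauchyLp_of_pos {z : ℂ} (hz : 0 < z.im) :
    hilbert (cauchyLp hz.ne') = (-Complex.I) • cauchyLp hz.ne' := by
  rw [hilbert_apply, Submodule.reflection_mem_subspace_eq_self (cauchyLp_mem_hardySpace hz)]

lemma hilbert_cauchyLp_of_neg {z : ℂ} (hz : z.im < 0) :
    hilbert (cauchyLp hz.ne) = Complex.I • cauchyLp hz.ne := by
  rw [hilbert_apply, Submodule.reflection_mem_subspace_orthogonalComplement_eq_neg
    (cauchyLp_mem_hardySpace_orthogonal hz), smul_neg, neg_smul, neg_neg]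

lemma integral_cauchyKernel_mul_of_pos {z : ℂ} (hz : 0 < z.im) (G : LineL2) :
    ∫ t, cauchyKernel z t * G t = -Complex.I * ∫ t, cauchyKernel z t * hilbert G t := by
  have hz' : (conj z).im < 0 := by simpa using hz
  have h := hilbert.inner_map_map (cauchyLp hz'.ne) G
  rw [hilbert_cauchyLp_of_neg hz', inner_smul_left, inner_cauchyLp, inner_cauchyLp,
    Complex.conj_conj, Complex.conj_I] at h
  exact h.symm

lemma integral_cauchyKernel_mul_of_neg {z : ℂ} (hz : z.im < 0) (G : LineL2) :
    ∫ t, cauchyKernel z t * G t = Complex.I * ∫ t, cauchyKernel z t * hilbert G t := by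
  have hz' : 0 < (conj z).im := by simpa using hz
  have h := hilbert.inner_map_map (cauchyLp hz'.ne') G
  rw [hilbert_cauchyLp_of_pos hz', inner_smul_left, inner_cauchyLp, inner_cauchyLp,
    Complex.conj_conj, map_neg, Complex.conj_I, neg_neg] at h
  exact h.symm

lemma integrable_cauchyKernel_mul {z : ℂ} (hz : z.im ≠ 0) (G : LineL2) :
    Integrable fun t => cauchyKernel z t * G t :=
  (memLp_cauchyKernel hz).integrable_mul (Lp.memLp G)

lemma conjPoisson_eq_cauchyKernel (a b t : ℝ) :
    (conjPoisson a b t : ℂ) = (cauchyKernel ⟨a, b⟩ t + cauchyKernel ⟨a, -b⟩ t) / 2 := by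
  simp only [cauchyKernel_eq, conjPoisson, poisson, neg_sq]
  push_cast
  ring

lemma poisson_eq_cauchyKernel (a b t : ℝ) :
    (poisson a b t : ℂ) = (cauchyKernel ⟨a, b⟩ t - cauchyKernel ⟨a, -b⟩ t) / (2 * Complex.I) := by
  simp only [cauchyKernel_eq, conjPoisson, poisson, neg_sq]
  have := Complex.I_ne_zero
  push_cast
  field_simp
  ring

lemma integrable_poisson_mul {b : ℝ} (hb : 0 < b) (a : ℝ) (G : LineL2) :
    Integrable fun t => (poisson a b t : ℂ) * G t := by
  simp_rw [poisson_eq_cauchyKernel, div_mul_eq_mul_div, sub_mul]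
  exact ((integrable_cauchyKernel_mul (z := ⟨a, b⟩) hb.ne' G).sub
    (integrable_cauchyKernel_mul (z := ⟨a, -b⟩) (neg_ne_zero.2 hb.ne') G)).div_const _

lemma integrable_conjPoisson_mul {b : ℝ} (hb : 0 < b) (a : ℝ) (G : LineL2) :
    Integrable fun t => (conjPoisson a b t : ℂ) * G t := by
  simp_rw [conjPoisson_eq_cauchyKernel, div_mul_eq_mul_div, add_mul]
  exact ((integrable_cauchyKernel_mul (z := ⟨a, b⟩) hb.ne' G).add
    (integrable_cauchyKernel_mul (z := ⟨a, -b⟩) (neg_ne_zero.2 hb.ne') G)).div_const _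

/-- The conjugate Poisson integral of `G` is the Poisson integral of its Hilbert transform. -/
lemma integral_conjPoisson_mul {b : ℝ} (hb : 0 < b) (a : ℝ) (G : LineL2) :
    ∫ t, (conjPoisson a b t : ℂ) * G t = ∫ t, (poisson a b t : ℂ) * hilbert G t := by
  have hp : 0 < (⟨a, b⟩ : ℂ).im := hb
  have hn : (⟨a, -b⟩ : ℂ).im < 0 := neg_lt_zero.2 hb
  simp_rw [conjPoisson_eq_cauchyKernel, poisson_eq_cauchyKernel, div_mul_eq_mul_div, add_mul,
    sub_mul]
  rw [integral_div, integral_div, integral_add (integrable_cauchyKernel_mul hp.ne' G)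
    (integrable_cauchyKernel_mul hn.ne G), integral_sub (integrable_cauchyKernel_mul hp.ne' _)
    (integrable_cauchyKernel_mul hn.ne _), integral_cauchyKernel_mul_of_pos hp,
    integral_cauchyKernel_mul_of_neg hn]
  have hI := Complex.I_ne_zero
  field_simp
  linear_combination (-(∫ t, cauchyKernel ⟨a, b⟩ t * hilbert G t) +
    ∫ t, cauchyKernel ⟨a, -b⟩ t * hilbert G t) * Complex.I_sq

lemma locallyIntegrable_coe (G : LineL2) : LocallyIntegrable G :=
  (Lp.memLp G).locallyIntegrable (by norm_num)

lemma ae_tendsto_poisson (G : LineL2) : ∀ᵐ s, ∀ a b : ℝ → ℝ, Tendsto b (𝓝[>] 0) (𝓝[>] 0) →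
    (∀ᶠ ε in 𝓝[>] 0, |a ε - s| ≤ b ε) →
    Tendsto (fun ε => ∫ r, (poisson (a ε) (b ε) r : ℂ) * G r) (𝓝[>] 0) (𝓝 (Real.pi * G s)) := by
  filter_upwards [ae_isLebesguePoint (locallyIntegrable_coe G)] with s hs a b hb hab
  exact hs.tendsto_poisson (locallyIntegrable_coe G)
    (fun a b hb => integrable_poisson_mul hb a G) hb hab

/-- The Hilbert transform is almost everywhere the limit of conjugate Poisson integrals. -/
lemma ae_tendsto_conjPoisson (G : LineL2) : ∀ᵐ s,
    Tendsto (fun ε => ∫ r, (conjPoisson s ε r : ℂ) * G r) (𝓝[>] 0)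
      (𝓝 (Real.pi * hilbert G s)) := by
  filter_upwards [ae_tendsto_poisson (hilbert G)] with s hs
  refine (hs (fun _ => s) id tendsto_id ?_).congr' ?_
  · filter_upwards [self_mem_nhdsWithin] with ε hε
    simpa using (mem_Ioi.1 hε).le
  · filter_upwards [self_mem_nhdsWithin] with ε hε
    exact (integral_conjPoisson_mul hε s G).symm

lemma conjPoisson_neg (a b r : ℝ) : conjPoisson (-a) b r = -conjPoisson a b (-r) := by
  unfold conjPoisson
  rw [show r - -a = -(-r - a) by ring, neg_sq, neg_div]

lemma integral_conjPoisson_neg {G : ℝ → ℂ} {c : ℂ} (h : ∀ᵐ r, G (-r) = c * G r) (a b : ℝ) :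
    ∫ r, (conjPoisson (-a) b r : ℂ) * G r = -c * ∫ r, (conjPoisson a b r : ℂ) * G r := by
  rw [← integral_neg_eq_self, ← integral_const_mul]
  refine integral_congr_ae ?_
  filter_upwards [h] with r hr
  rw [conjPoisson_neg, neg_neg, hr]
  push_cast
  ring

lemma ae_neg {P : ℝ → Prop} (h : ∀ᵐ r, P r) : ∀ᵐ r, P (-r) :=
  (Measure.measurePreserving_neg (volume : Measure ℝ)).quasiMeasurePreserving.ae h

/-- The Hilbert transform exchanges even and odd functions. -/
lemma hilbert_neg {G : LineL2} {c : ℂ} (h : ∀ᵐ r, G (-r) = c * G r) :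
    ∀ᵐ s, hilbert G (-s) = -c * hilbert G s := by
  filter_upwards [ae_tendsto_conjPoisson G, ae_neg (ae_tendsto_conjPoisson G)] with s h1 h2
  simp_rw [integral_conjPoisson_neg h] at h2
  have h3 := tendsto_nhds_unique h2 (h1.const_mul (-c))
  have hpi : (Real.pi : ℂ) ≠ 0 := by exact_mod_cast Real.pi_ne_zero
  apply mul_left_cancel₀ hpi
  rw [h3]; ring

/-! ### The substitution `x = s ^ 2` -/

/-- The squaring map carries Lebesgue measure on the line to the measure `x ^ (-1/2) dx` on the
half-axis; there is no constant because both square roots of `x` contribute. -/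
lemma measurePreserving_sq :
    MeasurePreserving (fun s : ℝ => s ^ 2) volume (halfAxisMeasure (-1 / 2)) := by
  have hm : Measurable fun s : ℝ => s ^ 2 := by fun_prop
  refine ⟨hm, Measure.ext fun A hA => ?_⟩
  set B : Set ℝ := (fun s : ℝ => s ^ 2) ⁻¹' A ∩ Ioi 0 with hB
  have hBm : MeasurableSet B := (hm hA).inter measurableSet_Ioi
  have himg : A ∩ Ioi 0 = (fun s : ℝ => s ^ 2) '' B := by
    ext x
    constructor
    · rintro ⟨hx, hx0⟩
      have h0 : Real.sqrt x ^ 2 = x := Real.sq_sqrt (mem_Ioi.1 hx0).le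
      exact ⟨Real.sqrt x, ⟨by simpa [h0] using hx, Real.sqrt_pos.2 hx0⟩, h0⟩
    · rintro ⟨s, ⟨hs, hs0⟩, rfl⟩
      exact ⟨hs, mem_Ioi.2 (pow_pos hs0 2)⟩
  have hright : halfAxisMeasure (-1 / 2) A = 2 * volume B := by
    rw [halfAxisMeasure, withDensity_apply _ hA, Measure.restrict_restrict hA, himg,
      lintegral_image_eq_lintegral_abs_deriv_mul (f' := fun s => 2 * s) hBm
        (fun s _ => by simpa using (hasDerivAt_pow 2 s).hasDerivWithinAt)]
    · rw [← setLIntegral_const]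
      refine setLIntegral_congr_fun hBm fun s hs => ?_
      have hs0 : 0 < s := hs.2
      have h1 : ((s ^ 2 : ℝ)) ^ (-1 / 2 : ℝ) = s⁻¹ := by
        rw [← Real.rpow_natCast, ← Real.rpow_mul hs0.le, ← Real.rpow_neg_one]
        norm_num
      rw [h1, ← ENNReal.ofReal_mul (abs_nonneg _), abs_of_pos (by positivity), mul_assoc,
        mul_inv_cancel₀ hs0.ne']
      simp
    · intro s hs t ht hst
      exact (pow_left_inj₀ (mem_Ioi.1 hs.2).le (mem_Ioi.1 ht.2).le two_ne_zero).1 hst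
  have hleft : volume ((fun s : ℝ => s ^ 2) ⁻¹' A) = 2 * volume B := by
    rw [← measure_inter_add_sdiff _ (measurableSet_Ioi (a := (0 : ℝ))), two_mul]
    congr 1
    rw [← (Measure.measurePreserving_neg (volume : Measure ℝ)).measure_preimage
      hBm.nullMeasurableSet]
    apply measure_congr
    have h0 : ∀ᵐ s : ℝ, s ≠ 0 := by simp [ae_iff, measure_singleton]
    filter_upwards [h0] with s hs
    apply propext
    change (s ^ 2 ∈ A ∧ ¬ (0 < s)) ↔ ((-s) ^ 2 ∈ A ∧ 0 < -s)
    rw [neg_sq, neg_pos, not_lt]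
    exact and_congr_right fun _ => ⟨fun h => lt_of_le_of_ne h hs, le_of_lt⟩
  rw [Measure.map_apply hm hA, hleft, hright]

lemma measurable_weight : Measurable fun x : ℝ => ENNReal.ofReal (x ^ (-1 / 2 : ℝ)) := by
  fun_prop

lemma restrict_Ioi_absolutelyContinuous :
    volume.restrict (Ioi (0 : ℝ)) ≪ halfAxisMeasure (-1 / 2) := by
  refine withDensity_absolutelyContinuous' measurable_weight.aemeasurable ?_
  filter_upwards [ae_restrict_mem measurableSet_Ioi] with x hx
  have : 0 < x ^ (-1 / 2 : ℝ) := Real.rpow_pos_of_pos hx _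
  simpa using this

lemma halfAxisMeasure_absolutelyContinuous :
    halfAxisMeasure (-1 / 2) ≪ volume.restrict (Ioi (0 : ℝ)) :=
  withDensity_absolutelyContinuous _ _

/-- The squaring map sends null sets to null sets. -/
lemma ae_Ioi_of_ae_sq {P : ℝ → Prop} (h : ∀ᵐ s : ℝ, 0 < s → P (s ^ 2)) :
    ∀ᵐ x ∂(volume.restrict (Ioi (0 : ℝ))), P x := by
  rw [ae_restrict_iff' measurableSet_Ioi]
  rw [ae_iff] at h ⊢
  have h1 := addHaar_image_eq_zero_of_differentiableOn_of_addHaar_eq_zero volume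
    (f := fun s : ℝ => s ^ 2) (by fun_prop) h
  refine measure_mono_null (fun x hx => ?_) h1
  simp only [mem_ofPred_eq, Classical.not_imp, mem_Ioi] at hx
  have h0 : Real.sqrt x ^ 2 = x := Real.sq_sqrt hx.1.le
  refine ⟨Real.sqrt x, ?_, h0⟩
  simp only [mem_ofPred_eq, Classical.not_imp, h0]
  exact ⟨Real.sqrt_pos.2 hx.1, hx.2⟩

lemma integrable_halfAxis_iff {g : ℝ → ℂ} : Integrable g (halfAxisMeasure (-1 / 2)) ↔
    IntegrableOn (fun x => ((x ^ (-1 / 2 : ℝ) : ℝ) : ℂ) * g x) (Ioi 0) := by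
  rw [halfAxisMeasure, integrable_withDensity_iff_integrable_smul' measurable_weight
    (ae_of_all _ fun x => ENNReal.ofReal_lt_top), IntegrableOn]
  refine integrable_congr ?_
  filter_upwards [ae_restrict_mem measurableSet_Ioi] with x hx
  rw [ENNReal.toReal_ofReal (Real.rpow_nonneg (mem_Ioi.1 hx).le _), Complex.real_smul]

lemma integral_halfAxis {g : ℝ → ℂ} : ∫ x, g x ∂(halfAxisMeasure (-1 / 2)) =
    ∫ x in Ioi 0, ((x ^ (-1 / 2 : ℝ) : ℝ) : ℂ) * g x := by
  rw [halfAxisMeasure, integral_withDensity_eq_integral_toReal_smul measurable_weight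
    (ae_of_all _ fun x => ENNReal.ofReal_lt_top)]
  refine integral_congr_ae ?_
  filter_upwards [ae_restrict_mem measurableSet_Ioi] with x hx
  rw [ENNReal.toReal_ofReal (Real.rpow_nonneg (mem_Ioi.1 hx).le _), Complex.real_smul]

lemma rpow_mul_sqrt {x : ℝ} (hx : 0 < x) : x ^ (-1 / 2 : ℝ) * Real.sqrt x = 1 := by
  rw [Real.sqrt_eq_rpow, ← Real.rpow_add hx]
  norm_num

lemma weight_mul_sqrt_mul {φ : ℝ → ℂ} {x : ℝ} (hx : 0 < x) :
    ((x ^ (-1 / 2 : ℝ) : ℝ) : ℂ) * ((Real.sqrt x : ℂ) * φ x) = φ x := by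
  rw [← mul_assoc, ← Complex.ofReal_mul, rpow_mul_sqrt hx, Complex.ofReal_one, one_mul]

lemma aestronglyMeasurable_sqrt_mul {φ : ℝ → ℂ}
    (hφ : AEStronglyMeasurable φ (volume.restrict (Ioi 0))) :
    AEStronglyMeasurable (fun x => (Real.sqrt x : ℂ) * φ x) (halfAxisMeasure (-1 / 2)) := by
  refine AEStronglyMeasurable.mul ?_ (hφ.mono_ac halfAxisMeasure_absolutelyContinuous)
  exact Continuous.aestronglyMeasurable (by fun_prop)

lemma integrableOn_Ioi_iff_sq {φ : ℝ → ℂ}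
    (hφ : AEStronglyMeasurable φ (volume.restrict (Ioi 0))) :
    IntegrableOn φ (Ioi 0) ↔ Integrable fun r : ℝ => ((|r| : ℝ) : ℂ) * φ (r ^ 2) := by
  have h1 : Integrable (fun x => (Real.sqrt x : ℂ) * φ x) (halfAxisMeasure (-1 / 2)) ↔
      IntegrableOn φ (Ioi 0) := by
    rw [integrable_halfAxis_iff]
    exact integrableOn_congr_fun (fun x hx => weight_mul_sqrt_mul hx) measurableSet_Ioi
  rw [← h1, ← measurePreserving_sq.integrable_comp (aestronglyMeasurable_sqrt_mul hφ)]
  simp only [Function.comp_def, Real.sqrt_sq_eq_abs]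

lemma integral_Ioi_eq_sq {φ : ℝ → ℂ}
    (hφ : AEStronglyMeasurable φ (volume.restrict (Ioi 0))) :
    ∫ x in Ioi 0, φ x = ∫ r : ℝ, ((|r| : ℝ) : ℂ) * φ (r ^ 2) := by
  have h1 : ∫ x, (Real.sqrt x : ℂ) * φ x ∂(halfAxisMeasure (-1 / 2)) = ∫ x in Ioi 0, φ x := by
    rw [integral_halfAxis]
    exact setIntegral_congr_fun measurableSet_Ioi fun x hx => weight_mul_sqrt_mul hx
  have h2 := aestronglyMeasurable_sqrt_mul hφ
  rw [← measurePreserving_sq.map_eq] at h1 h2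
  rw [← h1, integral_map measurePreserving_sq.measurable.aemeasurable h2]
  simp only [Real.sqrt_sq_eq_abs]

/-! ### The half-Hilbert transform as an operator -/

/-- The isometry `f ↦ (s ↦ f (s ^ 2))` of the weighted space onto the even functions in `L²`. -/
noncomputable def evenExt : HalfAxisL2 (-1 / 2) →ₗᵢ[ℂ] LineL2 :=
  Lp.compMeasurePreservingₗᵢ ℂ (fun s : ℝ => s ^ 2) measurePreserving_sq

lemma coe_evenExt (f : HalfAxisL2 (-1 / 2)) : evenExt f =ᵐ[volume] fun s => f (s ^ 2) :=
  Lp.coeFn_compMeasurePreserving f measurePreserving_sq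

lemma evenExt_even (f : HalfAxisL2 (-1 / 2)) : ∀ᵐ s, evenExt f (-s) = evenExt f s := by
  filter_upwards [coe_evenExt f, ae_neg (coe_evenExt f)] with s h1 h2
  rw [h1, h2, neg_sq]

/-- Every even square integrable function is a function of `s ^ 2`. -/
lemma exists_evenExt_eq {g : LineL2} (h : ∀ᵐ s, g (-s) = g s) : ∃ f, evenExt f = g := by
  have hcomp : (fun x => g (Real.sqrt x)) ∘ (fun s : ℝ => s ^ 2) =ᵐ[volume] g := by
    filter_upwards [h] with s hs
    rw [Function.comp_apply, Real.sqrt_sq_eq_abs]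
    rcases abs_choice s with h0 | h0 <;> rw [h0]
    exact hs
  have hsm : StronglyMeasurable fun x => g (Real.sqrt x) :=
    (Lp.stronglyMeasurable g).comp_measurable (by fun_prop)
  have hmem : MemLp (fun x => g (Real.sqrt x)) 2 (halfAxisMeasure (-1 / 2)) := by
    refine ⟨hsm.aestronglyMeasurable, ?_⟩
    rw [← eLpNorm_comp_measurePreserving hsm.aestronglyMeasurable measurePreserving_sq,
      eLpNorm_congr_ae hcomp]
    exact (Lp.memLp g).2
  refine ⟨hmem.toLp _, ?_⟩
  apply Lp.ext
  refine (coe_evenExt _).trans (EventuallyEq.trans ?_ hcomp)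
  exact measurePreserving_sq.quasiMeasurePreserving.ae hmem.coeFn_toLp

/-- The sign of a real number, with the value `1` at `0`. -/
noncomputable def sgn (r : ℝ) : ℂ := if r < 0 then -1 else 1

lemma norm_sgn (r : ℝ) : ‖sgn r‖ = 1 := by unfold sgn; split_ifs <;> simp

lemma sgn_mul_sgn (r : ℝ) : sgn r * sgn r = 1 := by unfold sgn; split_ifs <;> simp

lemma sgn_neg {r : ℝ} (hr : r ≠ 0) : sgn (-r) = -sgn r := by
  unfold sgn
  rcases lt_or_gt_of_ne hr with h | h
  · rw [if_pos h, if_neg (by linarith), neg_neg]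
  · rw [if_neg (not_lt.2 h.le), if_pos (by linarith)]

lemma abs_eq_mul_sgn (r : ℝ) : ((|r| : ℝ) : ℂ) = r * sgn r := by
  unfold sgn
  split_ifs with h
  · rw [abs_of_neg h]; push_cast; ring
  · rw [abs_of_nonneg (not_lt.1 h), mul_one]

lemma measurable_sgn : Measurable sgn :=
  Measurable.ite measurableSet_Iio measurable_const measurable_const

lemma memLp_sgn_mul (G : LineL2) : MemLp (fun r => sgn r * G r) 2 := by
  refine (Lp.memLp G).of_le (measurable_sgn.aestronglyMeasurable.mul (Lp.aestronglyMeasurable G))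
    (ae_of_all _ fun r => ?_)
  rw [norm_mul, norm_sgn, one_mul]

/-- Multiplication by the sign function. -/
noncomputable def signMul : LineL2 →ₗᵢ[ℂ] LineL2 where
  toFun G := (memLp_sgn_mul G).toLp _
  map_add' F G := by
    apply Lp.ext
    filter_upwards [(memLp_sgn_mul (F + G)).coeFn_toLp, (memLp_sgn_mul F).coeFn_toLp,
      (memLp_sgn_mul G).coeFn_toLp, Lp.coeFn_add F G,
      Lp.coeFn_add ((memLp_sgn_mul F).toLp _) ((memLp_sgn_mul G).toLp _)] with r h1 h2 h3 h4 h5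
    rw [h1, h5, Pi.add_apply, h2, h3, h4, Pi.add_apply, mul_add]
  map_smul' c G := by
    apply Lp.ext
    filter_upwards [(memLp_sgn_mul (c • G)).coeFn_toLp, (memLp_sgn_mul G).coeFn_toLp,
      Lp.coeFn_smul c G, Lp.coeFn_smul c ((memLp_sgn_mul G).toLp _)] with r h1 h2 h3 h4
    rw [h1, RingHom.id_apply, h4, Pi.smul_apply, h2, h3, Pi.smul_apply, smul_eq_mul, smul_eq_mul,
      mul_left_comm]
  norm_map' G := by
    change ‖(memLp_sgn_mul G).toLp _‖ = _
    rw [Lp.norm_toLp, Lp.norm_def]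
    congr 1
    refine eLpNorm_congr_norm_ae (ae_of_all _ fun r => ?_)
    rw [norm_mul, norm_sgn, one_mul]

lemma coe_signMul (G : LineL2) : signMul G =ᵐ[volume] fun r => sgn r * G r :=
  (memLp_sgn_mul G).coeFn_toLp

lemma signMul_signMul (G : LineL2) : signMul (signMul G) = G := by
  apply Lp.ext
  filter_upwards [coe_signMul (signMul G), coe_signMul G] with r h1 h2
  rw [h1, h2, ← mul_assoc, sgn_mul_sgn, one_mul]

lemma signMul_neg {G : LineL2} {c : ℂ} (h : ∀ᵐ r, G (-r) = c * G r) :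
    ∀ᵐ r, signMul G (-r) = -c * signMul G r := by
  have h0 : ∀ᵐ r : ℝ, r ≠ 0 := by simp [ae_iff, measure_singleton]
  filter_upwards [h, h0, coe_signMul G, ae_neg (coe_signMul G)] with r h1 h2 h3 h4
  rw [h3, h4, h1, sgn_neg h2]; ring

lemma signMul_evenExt_odd (f : HalfAxisL2 (-1 / 2)) :
    ∀ᵐ r, signMul (evenExt f) (-r) = -1 * signMul (evenExt f) r :=
  signMul_neg (by simpa only [one_mul] using evenExt_even f)

/-- The half-Hilbert transform in the variable `s = √x`: the Hilbert transform of the odd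
extension of `f (s ^ 2)`. -/
noncomputable def halfHilbertLine : HalfAxisL2 (-1 / 2) →ₗᵢ[ℂ] LineL2 :=
  hilbert.comp (signMul.comp evenExt)

lemma range_halfHilbertLine :
    LinearMap.range halfHilbertLine.toLinearMap = LinearMap.range evenExt.toLinearMap := by
  ext g
  constructor
  · rintro ⟨f, rfl⟩
    refine exists_evenExt_eq ?_
    filter_upwards [hilbert_neg (signMul_evenExt_odd f)] with s hs
    rw [neg_neg, one_mul] at hs
    exact hs
  · rintro ⟨h, rfl⟩
    have h1 := hilbert_neg (c := 1) (by simpa only [one_mul] using evenExt_even h)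
    obtain ⟨f, hf⟩ := exists_evenExt_eq (g := signMul (-hilbert (evenExt h))) (by
      rw [map_neg]
      filter_upwards [signMul_neg h1, Lp.coeFn_neg (signMul (hilbert (evenExt h))),
        ae_neg (Lp.coeFn_neg (signMul (hilbert (evenExt h))))] with s h2 h3 h4
      rw [h3, h4, Pi.neg_apply, Pi.neg_apply, h2, neg_neg, one_mul])
    refine ⟨f, ?_⟩
    change hilbert (signMul (evenExt f)) = evenExt h
    rw [hf, signMul_signMul, map_neg, hilbert_hilbert, neg_neg]

/-- The half-Hilbert transform as an isometric automorphism of the weighted space. -/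
noncomputable def halfHilbert : HalfAxisL2 (-1 / 2) ≃ₗᵢ[ℂ] HalfAxisL2 (-1 / 2) :=
  halfHilbertLine.equivRange.trans
    ((LinearIsometryEquiv.ofEq _ _ range_halfHilbertLine).trans evenExt.equivRange.symm)

lemma evenExt_halfHilbert (f : HalfAxisL2 (-1 / 2)) :
    evenExt (halfHilbert f) = hilbert (signMul (evenExt f)) := by
  have h := evenExt.equivRange.apply_symm_apply
    (LinearIsometryEquiv.ofEq _ _ range_halfHilbertLine (halfHilbertLine.equivRange f))
  exact congrArg Subtype.val h

/-! ### Principal values on the half-axis -/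

lemma aestronglyMeasurable_coe (f : HalfAxisL2 (-1 / 2)) :
    AEStronglyMeasurable f (volume.restrict (Ioi 0)) :=
  (Lp.aestronglyMeasurable f).mono_ac restrict_Ioi_absolutelyContinuous

lemma conjPoisson_sq {b : ℝ} (hb : 0 < b) (a r : ℝ) :
    r * conjPoisson (a ^ 2 - b ^ 2) (2 * a * b) (r ^ 2) =
      (conjPoisson a b r + conjPoisson (-a) b r) / 2 := by
  have h1 := den_pos hb (r - a)
  have h2 := den_pos hb (r - -a)
  have h3 : (r ^ 2 - (a ^ 2 - b ^ 2)) ^ 2 + (2 * a * b) ^ 2 =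
      ((r - a) ^ 2 + b ^ 2) * ((r - -a) ^ 2 + b ^ 2) := by ring
  unfold conjPoisson
  rw [h3]
  field_simp
  ring

/-- With `(a + b i)² = x + ε i`, the conjugate Poisson integral of `f` at `x + ε i` is the Poisson
integral of the half-Hilbert transform at `a + b i`, in the variable `√t`. -/
lemma integral_Ioi_conjPoisson_mul (f : HalfAxisL2 (-1 / 2)) {a b : ℝ} (ha : 0 < a) (hb : 0 < b) :
    ∫ t in Ioi 0, (conjPoisson (a ^ 2 - b ^ 2) (2 * a * b) t : ℂ) * f t =
      ∫ r, (poisson a b r : ℂ) * evenExt (halfHilbert f) r := by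
  have hm : AEStronglyMeasurable
      (fun t => (conjPoisson (a ^ 2 - b ^ 2) (2 * a * b) t : ℂ) * f t)
      (volume.restrict (Ioi 0)) := by
    refine AEStronglyMeasurable.mul ?_ (aestronglyMeasurable_coe f)
    have := continuous_conjPoisson (show 0 < 2 * a * b by positivity) (a ^ 2 - b ^ 2)
    exact (Complex.continuous_ofReal.comp this).aestronglyMeasurable
  set G := signMul (evenExt f) with hG
  have h1 : ∫ r : ℝ, ((|r| : ℝ) : ℂ) *
      ((conjPoisson (a ^ 2 - b ^ 2) (2 * a * b) (r ^ 2) : ℂ) * f (r ^ 2)) =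
      ∫ r, ((conjPoisson a b r : ℂ) * G r + (conjPoisson (-a) b r : ℂ) * G r) / 2 := by
    refine integral_congr_ae ?_
    filter_upwards [coe_signMul (evenExt f), coe_evenExt f] with r h1 h2
    have h3 : (r : ℂ) * (conjPoisson (a ^ 2 - b ^ 2) (2 * a * b) (r ^ 2) : ℂ) =
        ((conjPoisson a b r : ℂ) + (conjPoisson (-a) b r : ℂ)) / 2 := by
      exact_mod_cast conjPoisson_sq hb a r
    rw [hG, h1, h2, abs_eq_mul_sgn]
    linear_combination (sgn r * f (r ^ 2)) * h3
  rw [integral_Ioi_eq_sq hm, h1, integral_div, integral_add (integrable_conjPoisson_mul hb a G)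
    (integrable_conjPoisson_mul hb (-a) G), integral_conjPoisson_neg (signMul_evenExt_odd f),
    neg_neg, one_mul, add_self_div_two, integral_conjPoisson_mul hb, evenExt_halfHilbert]

/-- The half-Hilbert transform is almost everywhere the limit of conjugate Poisson integrals. -/
lemma ae_tendsto_Ioi_conjPoisson (f : HalfAxisL2 (-1 / 2)) :
    ∀ᵐ x ∂(volume.restrict (Ioi (0 : ℝ))),
      Tendsto (fun ε => ∫ t in Ioi 0, (conjPoisson x ε t : ℂ) * f t) (𝓝[>] 0)
        (𝓝 (Real.pi * halfHilbert f x)) := by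
  apply ae_Ioi_of_ae_sq
  filter_upwards [ae_tendsto_poisson (evenExt (halfHilbert f)), coe_evenExt (halfHilbert f)]
    with s hs hs2 hs0
  rw [← hs2]
  -- `a + b i` is the square root of `s² + ε i` in the first quadrant
  set m : ℝ → ℝ := fun ε => Real.sqrt ((s ^ 2) ^ 2 + ε ^ 2) with hm
  set a : ℝ → ℝ := fun ε => Real.sqrt ((s ^ 2 + m ε) / 2) with ha
  set b : ℝ → ℝ := fun ε => ε / (2 * a ε) with hb
  have hm2 (ε : ℝ) : m ε ^ 2 = (s ^ 2) ^ 2 + ε ^ 2 := Real.sq_sqrt (by positivity)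
  have hms (ε : ℝ) : s ^ 2 ≤ m ε := Real.le_sqrt_of_sq_le (by nlinarith [sq_nonneg ε])
  have ha2 (ε : ℝ) : a ε ^ 2 = (s ^ 2 + m ε) / 2 :=
    Real.sq_sqrt (by have := hms ε; positivity)
  have has (ε : ℝ) : s ≤ a ε := Real.le_sqrt_of_sq_le (by have := hms ε; linarith)
  have ha0 (ε : ℝ) : 0 < a ε := hs0.trans_le (has ε)
  have hab (ε : ℝ) : 2 * a ε * b ε = ε := by
    have := (ha0 ε).ne'
    simp only [hb]; field_simp
  have hb2 (ε : ℝ) : a ε ^ 2 - b ε ^ 2 = s ^ 2 := by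
    have h1 : 4 * a ε ^ 2 * b ε ^ 2 = ε ^ 2 := by
      calc _ = (2 * a ε * b ε) ^ 2 := by ring
        _ = _ := by rw [hab]
    have h2 := ha2 ε
    have h3 := hm2 ε
    have h4 : 0 < a ε ^ 2 := pow_pos (ha0 ε) 2
    have h5 : m ε = 2 * a ε ^ 2 - s ^ 2 := by linarith
    rw [h5] at h3
    have h6 : a ε ^ 2 * (a ε ^ 2 - b ε ^ 2 - s ^ 2) = 0 := by linarith
    have := (mul_eq_zero.1 h6).resolve_left h4.ne'
    linarith
  have hbpos {ε : ℝ} (hε : 0 < ε) : 0 < b ε := div_pos hε (mul_pos two_pos (ha0 ε))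
  have hblim : Tendsto b (𝓝[>] 0) (𝓝[>] 0) := by
    refine tendsto_nhdsWithin_iff.2 ⟨?_, ?_⟩
    · have h1 : Tendsto (fun ε : ℝ => ε / (2 * s)) (𝓝[>] 0) (𝓝 0) := by
        have : Tendsto (fun ε : ℝ => ε / (2 * s)) (𝓝 0) (𝓝 (0 / (2 * s))) :=
          tendsto_id.div_const _
        rw [zero_div] at this
        exact this.mono_left nhdsWithin_le_nhds
      refine squeeze_zero' ?_ ?_ h1
      · filter_upwards [self_mem_nhdsWithin] with ε hε using (hbpos hε).le
      · filter_upwards [self_mem_nhdsWithin] with ε hε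
        have hε' : 0 ≤ ε := (mem_Ioi.1 hε).le
        have := has ε
        simp only [hb]
        gcongr
    · filter_upwards [self_mem_nhdsWithin] with ε hε using hbpos hε
  have hlim := hs a b hblim (by
    filter_upwards [self_mem_nhdsWithin] with ε hε
    have h1 := hbpos hε
    have h2 := hb2 ε
    have h3 := has ε
    have h4 : b ε ≤ a ε := by nlinarith [sq_nonneg s, ha0 ε]
    rw [abs_of_nonneg (by linarith)]
    nlinarith)
  refine hlim.congr' ?_
  filter_upwards [self_mem_nhdsWithin] with ε hε
  rw [← integral_Ioi_conjPoisson_mul f (ha0 ε) (hbpos hε), hb2, hab]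

lemma integrable_abs_mul_inv_mul (G : LineL2) :
    Integrable fun r : ℝ => ((|r| * (1 + r ^ 2)⁻¹ : ℝ) : ℂ) * G r := by
  have hc : Continuous fun r : ℝ => |r| * (1 + r ^ 2)⁻¹ :=
    continuous_abs.mul (Continuous.inv₀ (by fun_prop) fun r => by positivity)
  have hmem : MemLp (fun r : ℝ => ((|r| * (1 + r ^ 2)⁻¹ : ℝ) : ℂ)) 2 := by
    have hm := (Complex.continuous_ofReal.comp hc).aestronglyMeasurable (μ := volume)
    refine (memLp_two_iff_integrable_sq_norm hm).2
      (integrable_inv_one_add_sq.mono' (by fun_prop) (ae_of_all _ fun r => ?_))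
    have h0 : 0 < 1 + r ^ 2 := by positivity
    rw [Function.comp_apply, Complex.norm_real, norm_pow, norm_norm, Real.norm_eq_abs, sq_abs,
      mul_pow, sq_abs, inv_pow, ← div_eq_mul_inv, div_le_iff₀ (by positivity)]
    field_simp
    linarith
  exact hmem.integrable_mul (Lp.memLp G)

/-- Kernels of decay `1 / t` at infinity are integrable against functions of the weighted space. -/
lemma integrableOn_kernel_mul (f : HalfAxisL2 (-1 / 2)) {k : ℝ → ℝ} (hk : Measurable k) {C : ℝ}
    (hC : ∀ t, 0 < t → |k t| * (1 + t) ≤ C) : IntegrableOn (fun t => (k t : ℂ) * f t) (Ioi 0) := by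
  have hbase : IntegrableOn (fun t : ℝ => (((1 + t)⁻¹ : ℝ) : ℂ) * f t) (Ioi 0) := by
    rw [integrableOn_Ioi_iff_sq]
    · refine (integrable_abs_mul_inv_mul (evenExt f)).congr ?_
      filter_upwards [coe_evenExt f] with r hr
      rw [hr]; push_cast; ring
    · refine AEStronglyMeasurable.mul ?_ (aestronglyMeasurable_coe f)
      exact Measurable.aestronglyMeasurable (by fun_prop)
  refine (hbase.norm.const_mul C).mono' ?_ ?_
  · refine AEStronglyMeasurable.mul ?_ (aestronglyMeasurable_coe f)
    exact Measurable.aestronglyMeasurable (by fun_prop)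
  · filter_upwards [ae_restrict_mem measurableSet_Ioi] with t ht
    have h0 : 0 < 1 + t := by have := mem_Ioi.1 ht; positivity
    rw [norm_mul, norm_mul, Complex.norm_real, Complex.norm_real, Real.norm_eq_abs,
      Real.norm_eq_abs, abs_of_pos (inv_pos.2 h0), ← mul_assoc, ← div_eq_mul_inv]
    gcongr
    rw [le_div_iff₀ h0]
    exact hC t ht

lemma integrableOn_poisson_mul (f : HalfAxisL2 (-1 / 2)) {x b : ℝ} (hx : 0 < x) (hb : 0 < b) :
    IntegrableOn (fun t => (poisson x b t : ℂ) * f t) (Ioi 0) := by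
  refine integrableOn_kernel_mul f (continuous_poisson hb x).measurable
    (C := (1 + x) / b + 1) fun t ht => ?_
  have hd := den_pos hb (t - x)
  rw [abs_of_nonneg (poisson_nonneg hb x t), poisson, div_mul_eq_mul_div, div_le_iff₀ hd]
  have h1 : (1 + x) * b ≤ (1 + x) / b * ((t - x) ^ 2 + b ^ 2) := by
    have : (1 + x) / b * b ^ 2 = (1 + x) * b := by field_simp
    have : 0 ≤ (1 + x) / b * (t - x) ^ 2 := by positivity
    linarith
  nlinarith [sq_nonneg (t - x - b), sq_nonneg (t - x), sq_nonneg b]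

lemma integrableOn_conjPoisson_mul (f : HalfAxisL2 (-1 / 2)) {x b : ℝ} (hx : 0 < x) (hb : 0 < b) :
    IntegrableOn (fun t => (conjPoisson x b t : ℂ) * f t) (Ioi 0) := by
  refine integrableOn_kernel_mul f (continuous_conjPoisson hb x).measurable
    (C := (1 + x) / b + 1) fun t ht => ?_
  have hd := den_pos hb (t - x)
  rw [conjPoisson, abs_div, abs_of_pos hd, div_mul_eq_mul_div, div_le_iff₀ hd, ← sq_abs (t - x)]
  have ht' : 1 + t ≤ 1 + x + |t - x| := by linarith [le_abs_self (t - x)]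
  have h1 : (1 + x) * |t - x| ≤ (1 + x) / b * (|t - x| ^ 2 + b ^ 2) := by
    rw [div_mul_eq_mul_div, le_div_iff₀ hb, mul_assoc]
    gcongr
    nlinarith [sq_nonneg (|t - x| - b), sq_nonneg (|t - x|), sq_nonneg b]
  nlinarith [mul_le_mul_of_nonneg_left ht' (abs_nonneg (t - x)), sq_nonneg b]

lemma integrableOn_truncKernel_mul (f : HalfAxisL2 (-1 / 2)) {x b : ℝ} (hx : 0 < x) (hb : 0 < b) :
    IntegrableOn (fun t => (truncKernel x b t : ℂ) * f t) (Ioi 0) := by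
  refine integrableOn_kernel_mul f (Measurable.indicator (by fun_prop) (measurableSet_trunc x b))
    (C := (1 + x) / b + 1) fun t ht => ?_
  by_cases h : b < |t - x|
  · rw [truncKernel, indicator_of_mem (by exact h), abs_div, abs_one, one_div_mul_eq_div,
      div_le_iff₀ (hb.trans h)]
    have ht' : 1 + t ≤ 1 + x + |t - x| := by linarith [le_abs_self (t - x)]
    have h1 : 1 + x ≤ (1 + x) / b * |t - x| := by
      rw [div_mul_eq_mul_div, le_div_iff₀ hb]; gcongr
    linarith
  · rw [truncKernel, indicator_of_notMem (by exact h), abs_zero, zero_mul]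
    positivity

lemma mul_indicator_Ioi (k : ℝ → ℝ) (f : ℝ → ℂ) :
    (fun t => (k t : ℂ) * (Ioi 0).indicator f t) = (Ioi 0).indicator fun t => (k t : ℂ) * f t := by
  ext t
  rw [indicator_mul_right]

lemma locallyIntegrable_indicator (f : HalfAxisL2 (-1 / 2)) :
    LocallyIntegrable ((Ioi (0 : ℝ)).indicator f) := by
  have h1 := integrableOn_poisson_mul f one_pos one_pos
  rw [← integrable_indicator_iff measurableSet_Ioi, ← mul_indicator_Ioi] at h1
  have h2 : LocallyIntegrableOn (fun t => ((t - 1) ^ 2 + 1 : ℝ) •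
      ((poisson 1 1 t : ℂ) * (Ioi 0).indicator f t)) univ :=
    (locallyIntegrableOn_univ.2 h1.locallyIntegrable).continuousOn_smul isOpen_univ.isLocallyClosed
      (Continuous.continuousOn (by fun_prop))
  rw [locallyIntegrableOn_univ] at h2
  convert h2 using 2 with t
  have h3 : ((t - 1) ^ 2 + 1) * poisson 1 1 t = 1 := by
    have := den_pos one_pos (t - 1)
    unfold poisson
    rw [one_pow] at *
    field_simp
  rw [Complex.real_smul, ← mul_assoc, ← Complex.ofReal_mul, h3, Complex.ofReal_one, one_mul]

lemma truncatedHalfAxis_eq (x ε : ℝ) :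
    truncatedHalfAxis x ε = Ioi 0 ∩ {t | ε < |t - x|} := rfl

lemma truncKernel_mul_eq (f : ℝ → ℂ) (x ε : ℝ) : (fun t => (truncKernel x ε t : ℂ) * f t) =
    {t | ε < |t - x|}.indicator fun t => f t / ((t - x : ℝ) : ℂ) := by
  ext t
  by_cases h : ε < |t - x|
  · rw [truncKernel, indicator_of_mem (by exact h), indicator_of_mem (by exact h)]
    push_cast; ring
  · rw [truncKernel, indicator_of_notMem (by exact h), indicator_of_notMem (by exact h)]
    simp

/-- The operator `halfHilbert` is given by the principal value integral. -/
lemma ae_hasHalfHilbertAt (f : HalfAxisL2 (-1 / 2)) :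
    ∀ᵐ x ∂(volume.restrict (Ioi (0 : ℝ))), HasHalfHilbertAt f x (halfHilbert f x) := by
  filter_upwards [ae_tendsto_Ioi_conjPoisson f, ae_restrict_mem measurableSet_Ioi,
    ae_restrict_of_ae (ae_isLebesguePoint (locallyIntegrable_indicator f))] with x hq hx hL
  replace hx : 0 < x := hx
  constructor
  · intro ε hε
    have h1 := integrableOn_truncKernel_mul f hx hε
    rw [truncKernel_mul_eq] at h1
    rw [truncatedHalfAxis_eq]
    refine (h1.mono_set inter_subset_left).congr_fun (fun t ht => ?_)
      (measurableSet_Ioi.inter (measurableSet_trunc x ε))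
    rw [indicator_of_mem ht.2]
  · have hind {k : ℝ → ℝ} (h : IntegrableOn (fun t => (k t : ℂ) * f t) (Ioi 0)) :
        Integrable fun t => (k t : ℂ) * (Ioi 0).indicator f t := by
      rwa [mul_indicator_Ioi, integrable_indicator_iff measurableSet_Ioi]
    have h1 := hL.tendsto_conjPoisson_sub_truncKernel (locallyIntegrable_indicator f)
      (fun b hb => hind (integrableOn_poisson_mul f hx hb))
      (fun b hb => hind (integrableOn_conjPoisson_mul f hx hb))
      (fun b hb => hind (integrableOn_truncKernel_mul f hx hb))
    simp_rw [mul_indicator_Ioi, integral_indicator measurableSet_Ioi, truncKernel_mul_eq,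
      setIntegral_indicator (measurableSet_trunc _ _)] at h1
    have h2 := (hq.sub h1).const_mul ((1 / Real.pi : ℝ) : ℂ)
    have hpi : (Real.pi : ℂ) ≠ 0 := by exact_mod_cast Real.pi_ne_zero
    have h3 : ((1 / Real.pi : ℝ) : ℂ) * (Real.pi * halfHilbert f x - 0) = halfHilbert f x := by
      push_cast; field_simp; ring
    rw [h3] at h2
    refine h2.congr fun ε => ?_
    rw [sub_sub_cancel, truncatedHalfAxis_eq]

/-! ### The inversion formula -/

lemma integrable_inv_add_abs_mul {s : ℝ} (hs : 0 < s) (G : LineL2) :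
    Integrable fun r : ℝ => (((s + |r|)⁻¹ : ℝ) : ℂ) * G r := by
  have h0 (r : ℝ) : 0 < s + |r| := by positivity
  have hc : Continuous fun r : ℝ => (s + |r|)⁻¹ :=
    Continuous.inv₀ (by fun_prop) fun r => (h0 r).ne'
  have hmem : MemLp (fun r : ℝ => (((s + |r|)⁻¹ : ℝ) : ℂ)) 2 := by
    have hm := (Complex.continuous_ofReal.comp hc).aestronglyMeasurable (μ := volume)
    refine (memLp_two_iff_integrable_sq_norm hm).2
      (((integrable_poisson hs 0).const_mul s⁻¹).mono' (hm.norm.pow 2) (ae_of_all _ fun r => ?_))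
    have h1 := den_pos hs r
    have h2 : s⁻¹ * poisson 0 s r = (r ^ 2 + s ^ 2)⁻¹ := by
      rw [poisson, sub_zero]; field_simp
    rw [h2, Function.comp_apply, Complex.norm_real, norm_pow, norm_norm, Real.norm_eq_abs, sq_abs,
      inv_pow]
    refine inv_anti₀ h1 ?_
    nlinarith [sq_abs r, abs_nonneg r]
  exact hmem.integrable_mul (Lp.memLp G)

lemma aestronglyMeasurable_inversion (h : HalfAxisL2 (-1 / 2)) (x : ℝ) :
    AEStronglyMeasurable
      (fun t : ℝ => h t / ((Real.sqrt x + Real.sqrt t : ℝ) : ℂ) * ((1 / Real.sqrt t : ℝ) : ℂ))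
      (volume.restrict (Ioi 0)) := by
  simp_rw [div_eq_mul_inv (h _)]
  refine ((aestronglyMeasurable_coe h).mul ?_).mul ?_
  · exact Measurable.aestronglyMeasurable (by fun_prop)
  · exact Measurable.aestronglyMeasurable (by fun_prop)

lemma inversion_integrand_ae (h : HalfAxisL2 (-1 / 2)) (x : ℝ) :
    (fun r : ℝ => ((|r| : ℝ) : ℂ) * (h (r ^ 2) / ((Real.sqrt x + Real.sqrt (r ^ 2) : ℝ) : ℂ) *
      ((1 / Real.sqrt (r ^ 2) : ℝ) : ℂ))) =ᵐ[volume]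
    fun r => (((Real.sqrt x + |r|)⁻¹ : ℝ) : ℂ) * evenExt h r := by
  have h0 : ∀ᵐ r : ℝ, r ≠ 0 := by simp [ae_iff, measure_singleton]
  filter_upwards [h0, coe_evenExt h] with r hr hA
  rw [hA, Real.sqrt_sq_eq_abs]
  have h1 : ((|r| : ℝ) : ℂ) ≠ 0 := by simpa using hr
  push_cast
  field_simp

lemma integrableOn_inversion (h : HalfAxisL2 (-1 / 2)) {x : ℝ} (hx : 0 < x) :
    IntegrableOn
      (fun t : ℝ => h t / ((Real.sqrt x + Real.sqrt t : ℝ) : ℂ) * ((1 / Real.sqrt t : ℝ) : ℂ))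
      (Ioi 0) := by
  rw [integrableOn_Ioi_iff_sq (aestronglyMeasurable_inversion h x),
    integrable_congr (inversion_integrand_ae h x)]
  exact integrable_inv_add_abs_mul (Real.sqrt_pos.2 hx) _

lemma integral_inversion (h : HalfAxisL2 (-1 / 2)) (x : ℝ) :
    ∫ t in Ioi (0 : ℝ),
      h t / ((Real.sqrt x + Real.sqrt t : ℝ) : ℂ) * ((1 / Real.sqrt t : ℝ) : ℂ) =
    ∫ r : ℝ, (((Real.sqrt x + |r|)⁻¹ : ℝ) : ℂ) * evenExt h r := by
  rw [integral_Ioi_eq_sq (aestronglyMeasurable_inversion h x),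
    integral_congr_ae (inversion_integrand_ae h x)]

lemma abs_conjPoisson_le {a b r : ℝ} (hr : r ≠ a) : |conjPoisson a b r| ≤ |r - a|⁻¹ := by
  have h0 : 0 < |r - a| := abs_pos.2 (sub_ne_zero.2 hr)
  have h1 : 0 < (r - a) ^ 2 + b ^ 2 := by rw [← sq_abs]; positivity
  rw [conjPoisson, abs_div, abs_of_pos h1, div_le_iff₀ h1, inv_mul_eq_div, le_div_iff₀ h0, ← sq,
    sq_abs]
  nlinarith [sq_nonneg b]

lemma tendsto_conjPoisson_zero {a r : ℝ} (hr : r ≠ a) :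
    Tendsto (fun ε => conjPoisson a ε r) (𝓝[>] 0) (𝓝 (r - a)⁻¹) := by
  have h0 : r - a ≠ 0 := sub_ne_zero.2 hr
  have h1 : ContinuousAt (fun ε => conjPoisson a ε r) 0 := by
    unfold conjPoisson
    exact ContinuousAt.div (by fun_prop) (by fun_prop) (by simpa using h0)
  have h2 : conjPoisson a 0 r = (r - a)⁻¹ := by unfold conjPoisson; field_simp; simp
  rw [← h2]
  exact h1.tendsto.mono_left nhdsWithin_le_nhds

/-- The odd and the even extension of `h (s ^ 2)` differ by a function supported in `(-∞, 0]`,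
whose Hilbert transform at `s > 0` is an absolutely convergent integral. -/
lemma ae_hilbert_signMul_sub (h : HalfAxisL2 (-1 / 2)) : ∀ᵐ s : ℝ, 0 < s →
    Real.pi * hilbert (signMul (evenExt h) - evenExt h) s =
      ∫ r : ℝ, (((s + |r|)⁻¹ : ℝ) : ℂ) * evenExt h r := by
  set D := signMul (evenExt h) - evenExt h with hD
  have hD' : ∀ᵐ r, D r = sgn r * evenExt h r - evenExt h r := by
    filter_upwards [Lp.coeFn_sub (signMul (evenExt h)) (evenExt h), coe_signMul (evenExt h)]
      with r h1 h2
    rw [hD, h1, Pi.sub_apply, h2]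
  have hD0 : ∀ᵐ r, 0 ≤ r → D r = 0 := by
    filter_upwards [hD'] with r h1 h2
    rw [h1, sgn, if_neg (not_lt.2 h2), one_mul, sub_self]
  filter_upwards [ae_tendsto_conjPoisson D] with s hs hs0
  refine tendsto_nhds_unique hs ?_
  have hlim : Tendsto (fun ε => ∫ r, (conjPoisson s ε r : ℂ) * D r) (𝓝[>] 0)
      (𝓝 (∫ r, (((r - s)⁻¹ : ℝ) : ℂ) * D r)) := by
    refine tendsto_integral_filter_of_dominated_convergence
      (fun r => ‖(((s + |r|)⁻¹ : ℝ) : ℂ) * D r‖) ?_ ?_ (integrable_inv_add_abs_mul hs0 D).norm ?_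
    · filter_upwards [self_mem_nhdsWithin] with ε hε
      exact (integrable_conjPoisson_mul hε s D).aestronglyMeasurable
    · refine Eventually.of_forall fun ε => ?_
      filter_upwards [hD0] with r hr
      rcases le_or_gt 0 r with h0 | h0
      · simp [hr h0]
      · rw [norm_mul, norm_mul, Complex.norm_real, Complex.norm_real]
        gcongr
        refine (abs_conjPoisson_le (by linarith : r ≠ s)).trans ?_
        rw [Real.norm_of_nonneg (by positivity), abs_of_neg h0, abs_of_neg (by linarith)]
        apply le_of_eq; ring
    · filter_upwards [hD0] with r hr
      rcases le_or_gt 0 r with h0 | h0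
      · simp [hr h0]
      · exact ((Complex.continuous_ofReal.tendsto _).comp
          (tendsto_conjPoisson_zero (by linarith : r ≠ s))).mul_const _
  convert hlim using 2
  -- the odd function `(s + |r|)⁻¹ * signMul (evenExt h) r` has integral zero
  have hodd : ∫ r : ℝ, (((s + |r|)⁻¹ : ℝ) : ℂ) * signMul (evenExt h) r = 0 := by
    have h1 := integral_neg_eq_self
      (fun r : ℝ => (((s + |r|)⁻¹ : ℝ) : ℂ) * signMul (evenExt h) r) volume
    have h2 : ∫ r : ℝ, (((s + |(-r)|)⁻¹ : ℝ) : ℂ) * signMul (evenExt h) (-r) =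
        - ∫ r : ℝ, (((s + |r|)⁻¹ : ℝ) : ℂ) * signMul (evenExt h) r := by
      rw [← integral_neg]
      refine integral_congr_ae ?_
      filter_upwards [signMul_evenExt_odd h] with r hr
      rw [hr, abs_neg]; ring
    rw [h2] at h1
    exact self_eq_neg.1 h1.symm
  rw [← sub_zero (∫ r : ℝ, (((s + |r|)⁻¹ : ℝ) : ℂ) * evenExt h r), ← hodd,
    ← integral_sub (integrable_inv_add_abs_mul hs0 _) (integrable_inv_add_abs_mul hs0 _)]
  refine integral_congr_ae ?_
  filter_upwards [hD0, Lp.coeFn_sub (signMul (evenExt h)) (evenExt h)] with r h1 h2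
  have h3 : D r = signMul (evenExt h) r - evenExt h r := h2
  rw [← mul_sub]
  rcases le_or_gt 0 r with h0 | h0
  · have h4 := h1 h0
    rw [h4, mul_zero, ← neg_sub, ← h3, h4, neg_zero, mul_zero]
  · rw [h3, abs_of_neg h0, show r - s = -(s + -r) by ring, inv_neg]
    push_cast
    ring

/-- The inversion formula for the half-Hilbert transform. -/
lemma ae_inversion (f : HalfAxisL2 (-1 / 2)) : ∀ᵐ x ∂(volume.restrict (Ioi (0 : ℝ))),
    f x = ((1 / Real.pi : ℝ) : ℂ) *
        (∫ t in Ioi (0 : ℝ), halfHilbert f t / ((Real.sqrt x + Real.sqrt t : ℝ) : ℂ) *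
          ((1 / Real.sqrt t : ℝ) : ℂ))
      - halfHilbert (halfHilbert f) x := by
  apply ae_Ioi_of_ae_sq
  set h := halfHilbert f with hh
  have h1 : hilbert (signMul (evenExt h) - evenExt h) =
      evenExt (halfHilbert h) + signMul (evenExt f) := by
    have h0 : hilbert (evenExt h) = -signMul (evenExt f) := by
      rw [hh, evenExt_halfHilbert f, hilbert_hilbert]
    rw [map_sub, evenExt_halfHilbert h, h0, sub_neg_eq_add]
  have h2 := ae_hilbert_signMul_sub h
  rw [h1] at h2
  filter_upwards [h2, Lp.coeFn_add (evenExt (halfHilbert h)) (signMul (evenExt f)),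
    coe_evenExt (halfHilbert h), coe_evenExt f, coe_signMul (evenExt f)] with s k1 k2 k3 k4 k5 hs
  rw [integral_inversion, Real.sqrt_sq hs.le, ← k1 hs, k2, Pi.add_apply, k3, k5, k4, sgn,
    if_neg (not_lt.2 hs.le)]
  have hpi : (Real.pi : ℂ) ≠ 0 := by exact_mod_cast Real.pi_ne_zero
  push_cast
  field_simp
  ring

/-! ### The logarithmic formula -/

lemma memLp_indicator_sqrt (b : ℝ) :
    MemLp ((Ioc 0 b).indicator fun x : ℝ => (Real.sqrt x : ℂ)) 2 (halfAxisMeasure (-1 / 2)) := by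
  rw [memLp_indicator_iff_restrict measurableSet_Ioc]
  have hfin : halfAxisMeasure (-1 / 2) (Ioc 0 b) < ⊤ := by
    rw [← measurePreserving_sq.measure_preimage measurableSet_Ioc.nullMeasurableSet]
    refine (measure_mono (t := Icc (-Real.sqrt b) (Real.sqrt b)) fun s hs => ?_).trans_lt
      measure_Icc_lt_top
    exact abs_le.1 (Real.abs_le_sqrt hs.2)
  have : Fact (halfAxisMeasure (-1 / 2) (Ioc 0 b) < ⊤) := ⟨hfin⟩
  refine MemLp.of_bound (Continuous.aestronglyMeasurable (by fun_prop)) (Real.sqrt b) ?_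
  filter_upwards [ae_restrict_mem measurableSet_Ioc] with x hx
  rw [Complex.norm_real, Real.norm_of_nonneg (Real.sqrt_nonneg x)]
  exact Real.sqrt_le_sqrt hx.2

/-- The function `√x` on `(0, b]` in the weighted space; pairing with it is integration over
`(0, b]`. -/
noncomputable def sqrtIndicator (b : ℝ) : HalfAxisL2 (-1 / 2) := (memLp_indicator_sqrt b).toLp _

lemma coe_sqrtIndicator (b : ℝ) : ∀ᵐ x ∂(volume.restrict (Ioi (0 : ℝ))),
    sqrtIndicator b x = (Ioc 0 b).indicator (fun x : ℝ => (Real.sqrt x : ℂ)) x :=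
  restrict_Ioi_absolutelyContinuous.ae_le (memLp_indicator_sqrt b).coeFn_toLp

lemma integral_mul_sqrtIndicator {b : ℝ} (hb : 0 < b) {k : ℝ → ℂ} :
    ∫ t in Ioi 0, k t * sqrtIndicator b t = ∫ t in (0 : ℝ)..b, k t * Real.sqrt t := by
  have h1 : ∫ t in Ioi 0, k t * sqrtIndicator b t =
      ∫ t in Ioi 0, (Ioc 0 b).indicator (fun t => k t * (Real.sqrt t : ℂ)) t := by
    refine integral_congr_ae ?_
    filter_upwards [coe_sqrtIndicator b] with t ht
    rw [ht, indicator_mul_right]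
  rw [h1, setIntegral_indicator measurableSet_Ioc, inter_eq_right.2 Ioc_subset_Ioi_self,
    intervalIntegral.integral_of_le hb.le]

lemma integral_conjPoisson {ε : ℝ} (hε : 0 < ε) (x b : ℝ) : ∫ t in (0 : ℝ)..b, conjPoisson x ε t =
    Real.log ((b - x) ^ 2 + ε ^ 2) / 2 - Real.log (x ^ 2 + ε ^ 2) / 2 := by
  have hder (t : ℝ) : HasDerivAt (fun t => Real.log ((t - x) ^ 2 + ε ^ 2) / 2)
      (conjPoisson x ε t) t := by
    have h1 : HasDerivAt (fun t => (t - x) ^ 2 + ε ^ 2) (2 * (t - x)) t := by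
      simpa using (((hasDerivAt_id t).sub_const x).pow 2).add_const (ε ^ 2)
    refine ((h1.log (den_pos hε _).ne').div_const 2).congr_deriv ?_
    unfold conjPoisson; ring
  rw [intervalIntegral.integral_eq_sub_of_hasDerivAt (fun t _ => hder t)
    ((continuous_conjPoisson hε x).intervalIntegrable _ _)]
  simp

lemma tendsto_integral_conjPoisson {x b : ℝ} (hx : 0 < x) (hxb : x ≠ b) :
    Tendsto (fun ε => ∫ t in (0 : ℝ)..b, conjPoisson x ε t) (𝓝[>] 0)
      (𝓝 (Real.log |1 - b / x|)) := by
  have hbx : b - x ≠ 0 := sub_ne_zero.2 hxb.symm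
  have hlog {y : ℝ} (hy : y ≠ 0) : Tendsto (fun ε : ℝ => Real.log (y ^ 2 + ε ^ 2) / 2) (𝓝[>] 0)
      (𝓝 (Real.log |y|)) := by
    have h1 : ContinuousAt (fun ε : ℝ => Real.log (y ^ 2 + ε ^ 2) / 2) 0 :=
      (ContinuousAt.log (by fun_prop) (by simpa using hy)).div_const 2
    have h2 : Real.log (y ^ 2 + 0 ^ 2) / 2 = Real.log |y| := by
      rw [zero_pow two_ne_zero, add_zero, Real.log_pow, Real.log_abs]; push_cast; ring
    rw [← h2]
    exact h1.tendsto.mono_left nhdsWithin_le_nhds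
  have h3 : Real.log |1 - b / x| = Real.log |b - x| - Real.log |x| := by
    rw [← Real.log_div (abs_ne_zero.2 hbx) (abs_ne_zero.2 hx.ne'), ← abs_div, sub_div,
      div_self hx.ne', abs_sub_comm]
  rw [h3]
  refine ((hlog hbx).sub (hlog hx.ne')).congr' ?_
  filter_upwards [self_mem_nhdsWithin] with ε hε
  exact (integral_conjPoisson hε x b).symm

lemma tendsto_integral_conjPoisson_mul_sqrt {x b : ℝ} (hx : 0 < x) (hb : 0 < b) (hxb : x ≠ b) :
    Tendsto (fun ε => ∫ t in (0 : ℝ)..b, conjPoisson x ε t * Real.sqrt t) (𝓝[>] 0)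
      (𝓝 (Real.sqrt x * Real.log |1 - b / x| +
        ∫ t in (0 : ℝ)..b, (Real.sqrt x + Real.sqrt t)⁻¹)) := by
  have hsx : 0 < Real.sqrt x := Real.sqrt_pos.2 hx
  have hpos (t : ℝ) : 0 < Real.sqrt x + Real.sqrt t := by positivity
  have hcont : Continuous fun t => (Real.sqrt x + Real.sqrt t)⁻¹ :=
    Continuous.inv₀ (by fun_prop) fun t => (hpos t).ne'
  have hrest : Tendsto (fun ε => ∫ t in (0 : ℝ)..b,
      conjPoisson x ε t * (t - x) * (Real.sqrt x + Real.sqrt t)⁻¹) (𝓝[>] 0)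
      (𝓝 (∫ t in (0 : ℝ)..b, (Real.sqrt x + Real.sqrt t)⁻¹)) := by
    have hne : ∀ᵐ t : ℝ, t ≠ x := by simp [ae_iff, measure_singleton]
    refine intervalIntegral.tendsto_integral_filter_of_dominated_convergence
      (fun t => (Real.sqrt x + Real.sqrt t)⁻¹) ?_ ?_ (hcont.intervalIntegrable _ _) ?_
    · filter_upwards [self_mem_nhdsWithin] with ε hε
      have := continuous_conjPoisson (mem_Ioi.1 hε) x
      exact Continuous.aestronglyMeasurable (by fun_prop)
    · refine Eventually.of_forall fun ε => ?_
      filter_upwards [hne] with t ht _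
      have h0 : 0 < |t - x| := abs_pos.2 (sub_ne_zero.2 ht)
      rw [norm_mul, norm_mul, Real.norm_of_nonneg (inv_nonneg.2 (hpos t).le), Real.norm_eq_abs,
        Real.norm_eq_abs]
      refine mul_le_of_le_one_left (inv_nonneg.2 (hpos t).le) ?_
      calc _ ≤ |t - x|⁻¹ * |t - x| := by gcongr; exact abs_conjPoisson_le ht
        _ = 1 := inv_mul_cancel₀ h0.ne'
    · filter_upwards [hne] with t ht _
      have h1 := ((tendsto_conjPoisson_zero ht).mul_const (t - x)).mul_const
        (Real.sqrt x + Real.sqrt t)⁻¹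
      rwa [inv_mul_cancel₀ (sub_ne_zero.2 ht), one_mul] at h1
  refine (((tendsto_integral_conjPoisson hx hxb).const_mul (Real.sqrt x)).add hrest).congr' ?_
  filter_upwards [self_mem_nhdsWithin] with ε hε
  have hq := continuous_conjPoisson (mem_Ioi.1 hε) x
  rw [← intervalIntegral.integral_const_mul, ← intervalIntegral.integral_add]
  · refine intervalIntegral.integral_congr_ae (ae_of_all _ fun t ht => ?_)
    rw [uIoc_of_le hb.le] at ht
    have h1 : t - x = (Real.sqrt t - Real.sqrt x) * (Real.sqrt x + Real.sqrt t) := by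
      nlinarith [Real.mul_self_sqrt ht.1.le, Real.mul_self_sqrt hx.le]
    have h2 : (t - x) * (Real.sqrt x + Real.sqrt t)⁻¹ = Real.sqrt t - Real.sqrt x := by
      rw [h1, mul_inv_cancel_right₀ (hpos t).ne']
    rw [mul_assoc, h2]
    ring
  · exact (Continuous.mul continuous_const hq).intervalIntegrable _ _
  · exact Continuous.intervalIntegrable (by fun_prop) _ _

/-- The inverse half-Hilbert transform of `√x` on `(0, b]` is a logarithmic kernel. -/
lemma ae_halfHilbert_symm_sqrtIndicator {b : ℝ} (hb : 0 < b) :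
    ∀ᵐ x ∂(volume.restrict (Ioi (0 : ℝ))), halfHilbert.symm (sqrtIndicator b) x =
      ((-(1 / Real.pi) * (Real.sqrt x * Real.log |1 - b / x|) : ℝ) : ℂ) := by
  have hinv := ae_inversion (halfHilbert.symm (sqrtIndicator b))
  rw [halfHilbert.apply_symm_apply] at hinv
  have hne : ∀ᵐ x : ℝ, x ≠ b := by simp [ae_iff, measure_singleton]
  filter_upwards [hinv, ae_tendsto_Ioi_conjPoisson (sqrtIndicator b), ae_restrict_of_ae hne,
    ae_restrict_mem measurableSet_Ioi] with x h1 h2 hxb hx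
  replace hx : 0 < x := hx
  simp_rw [integral_mul_sqrtIndicator hb, ← Complex.ofReal_mul,
    intervalIntegral.integral_ofReal] at h2
  have h3 := tendsto_nhds_unique h2
    ((Complex.continuous_ofReal.tendsto _).comp (tendsto_integral_conjPoisson_mul_sqrt hx hb hxb))
  have h4 : ∫ t in Ioi (0 : ℝ), sqrtIndicator b t / ((Real.sqrt x + Real.sqrt t : ℝ) : ℂ) *
      ((1 / Real.sqrt t : ℝ) : ℂ) =
      ((∫ t in (0 : ℝ)..b, (Real.sqrt x + Real.sqrt t)⁻¹ : ℝ) : ℂ) := by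
    have h5 : ∀ t, sqrtIndicator b t / ((Real.sqrt x + Real.sqrt t : ℝ) : ℂ) *
        ((1 / Real.sqrt t : ℝ) : ℂ) =
        (((Real.sqrt x + Real.sqrt t)⁻¹ * (1 / Real.sqrt t) : ℝ) : ℂ) * sqrtIndicator b t := by
      intro t; push_cast; ring
    simp_rw [h5]
    rw [integral_mul_sqrtIndicator hb, ← intervalIntegral.integral_ofReal]
    refine intervalIntegral.integral_congr_ae (ae_of_all _ fun t ht => ?_)
    rw [uIoc_of_le hb.le] at ht
    have h6 : Real.sqrt t ≠ 0 := (Real.sqrt_pos.2 ht.1).ne'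
    rw [← Complex.ofReal_mul, mul_assoc, one_div_mul_cancel h6, mul_one]
  rw [h1, h4]
  have hpi : (Real.pi : ℂ) ≠ 0 := by exact_mod_cast Real.pi_ne_zero
  apply mul_left_cancel₀ hpi
  rw [mul_sub, h3]
  push_cast
  field_simp
  ring

lemma log_kernel_ae (f : HalfAxisL2 (-1 / 2)) {b : ℝ} (hb : 0 < b) :
    (fun t : ℝ => ((t ^ (-1 / 2 : ℝ) : ℝ) : ℂ) *
      inner ℂ (halfHilbert.symm (sqrtIndicator b) t) (f t)) =ᵐ[volume.restrict (Ioi 0)]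
    fun t => -((1 / Real.pi : ℝ) : ℂ) * (((Real.log |1 - b / t| : ℝ) : ℂ) * f t) := by
  filter_upwards [ae_halfHilbert_symm_sqrtIndicator hb, ae_restrict_mem measurableSet_Ioi]
    with t ht ht0
  have h1 : ((t ^ (-1 / 2 : ℝ) : ℝ) : ℂ) * (Real.sqrt t : ℂ) = 1 := by
    exact_mod_cast rpow_mul_sqrt ht0
  rw [ht, RCLike.inner_apply, Complex.conj_ofReal]
  push_cast at h1 ⊢
  linear_combination (-(1 / Real.pi : ℂ) * (Real.log |1 - b / t| : ℂ) * f t) * h1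

lemma integrableOn_log_mul (f : HalfAxisL2 (-1 / 2)) {b : ℝ} (hb : 0 < b) :
    IntegrableOn (fun t : ℝ => ((Real.log |1 - b / t| : ℝ) : ℂ) * f t) (Ioi 0) := by
  have h1 := L2.integrable_inner (𝕜 := ℂ) (halfHilbert.symm (sqrtIndicator b)) f
  rw [integrable_halfAxis_iff, IntegrableOn, integrable_congr (log_kernel_ae f hb)] at h1
  have hpi : -((1 / Real.pi : ℝ) : ℂ) ≠ 0 := by
    rw [neg_ne_zero, Complex.ofReal_ne_zero]; exact one_div_ne_zero Real.pi_ne_zero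
  exact (integrable_const_mul_iff hpi.isUnit _).1 h1

/-- The logarithmic potential of `f` is, up to the factor `-π`, a primitive of its half-Hilbert
transform. -/
lemma integral_log_mul (f : HalfAxisL2 (-1 / 2)) {b : ℝ} (hb : 0 < b) :
    ∫ t in Ioi (0 : ℝ), ((Real.log |1 - b / t| : ℝ) : ℂ) * f t =
      -Real.pi * ∫ t in (0 : ℝ)..b, halfHilbert f t := by
  have h1 : inner ℂ (halfHilbert.symm (sqrtIndicator b)) f =
      inner ℂ (sqrtIndicator b) (halfHilbert f) := by
    rw [← halfHilbert.inner_map_map, halfHilbert.apply_symm_apply]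
  rw [L2.inner_def, L2.inner_def, integral_halfAxis, integral_halfAxis,
    integral_congr_ae (log_kernel_ae f hb), integral_const_mul] at h1
  have h2 : ∫ t in Ioi (0 : ℝ), ((t ^ (-1 / 2 : ℝ) : ℝ) : ℂ) *
      inner ℂ (sqrtIndicator b t) (halfHilbert f t) = ∫ t in (0 : ℝ)..b, halfHilbert f t := by
    have h3 : ∫ t in Ioi (0 : ℝ), ((t ^ (-1 / 2 : ℝ) : ℝ) : ℂ) *
        inner ℂ (sqrtIndicator b t) (halfHilbert f t) =
        ∫ t in Ioi (0 : ℝ), (Ioc 0 b).indicator (fun t => halfHilbert f t) t := by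
      refine integral_congr_ae ?_
      filter_upwards [coe_sqrtIndicator b, ae_restrict_mem measurableSet_Ioi] with t ht ht0
      rw [ht, RCLike.inner_apply]
      by_cases h : t ∈ Ioc 0 b
      · rw [indicator_of_mem h, indicator_of_mem h, Complex.conj_ofReal, mul_comm (halfHilbert f t),
          weight_mul_sqrt_mul (φ := fun t => halfHilbert f t) ht0]
      · rw [indicator_of_notMem h, indicator_of_notMem h, map_zero, mul_zero, mul_zero]
    rw [h3, setIntegral_indicator measurableSet_Ioc, inter_eq_right.2 Ioc_subset_Ioi_self,
      intervalIntegral.integral_of_le hb.le]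
  rw [h2] at h1
  have hpi : (Real.pi : ℂ) ≠ 0 := by exact_mod_cast Real.pi_ne_zero
  rw [← h1]
  push_cast
  field_simp

lemma ae_hasDerivAt_integral_log (f : HalfAxisL2 (-1 / 2)) :
    ∀ᵐ x ∂(volume.restrict (Ioi (0 : ℝ))),
      HasDerivAt (fun y : ℝ => ∫ t in Ioi (0 : ℝ), ((Real.log |1 - y / t| : ℝ) : ℂ) * f t)
        (-Real.pi * halfHilbert f x) x := by
  filter_upwards [ae_restrict_of_ae
    (LocallyIntegrable.ae_hasDerivAt_integral (locallyIntegrable_indicator (halfHilbert f))),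
    ae_restrict_mem measurableSet_Ioi] with x hx hx0
  have h1 := (hx 0).const_mul (-(Real.pi : ℂ))
  rw [indicator_of_mem hx0] at h1
  refine h1.congr_of_eventuallyEq ?_
  filter_upwards [Ioi_mem_nhds (mem_Ioi.1 hx0)] with y hy
  rw [integral_log_mul f hy]
  congr 1
  refine intervalIntegral.integral_congr_ae (ae_of_all _ fun t ht => ?_)
  rw [uIoc_of_le (mem_Ioi.1 hy).le] at ht
  exact (indicator_of_mem (s := Ioi (0 : ℝ)) ht.1 _).symm

end HalfHilbert

theorem corollary1 :
    ∃ H : HalfAxisL2 (-1 / 2) ≃ₗᵢ[ℂ] HalfAxisL2 (-1 / 2),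
      -- `H` is the half-Hilbert transform, given by the principal value integral
      (∀ f : HalfAxisL2 (-1 / 2),
        ∀ᵐ x ∂(volume.restrict (Ioi (0 : ℝ))), HasHalfHilbertAt f x (H f x)) ∧
      -- first reciprocal formula
      (∀ f : HalfAxisL2 (-1 / 2),
        (∀ x : ℝ, 0 < x →
          IntegrableOn (fun t : ℝ => ((Real.log |1 - x / t| : ℝ) : ℂ) * f t) (Ioi (0 : ℝ))) ∧
        ∀ᵐ x ∂(volume.restrict (Ioi (0 : ℝ))),
          ∃ d : ℂ,
            HasDerivAt
              (fun y : ℝ => ∫ t in Ioi (0 : ℝ), ((Real.log |1 - y / t| : ℝ) : ℂ) * f t) d x ∧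
            H f x = -((1 / Real.pi : ℝ) : ℂ) * d) ∧
      -- second reciprocal formula, with `h = H f`
      (∀ f h : HalfAxisL2 (-1 / 2), h = H f →
        (∀ x : ℝ, 0 < x →
          IntegrableOn
            (fun t : ℝ => h t / ((Real.sqrt x + Real.sqrt t : ℝ) : ℂ) * ((1 / Real.sqrt t : ℝ) : ℂ))
            (Ioi (0 : ℝ))) ∧
        ∀ᵐ x ∂(volume.restrict (Ioi (0 : ℝ))),
          f x = ((1 / Real.pi : ℝ) : ℂ) *
              (∫ t in Ioi (0 : ℝ),
                h t / ((Real.sqrt x + Real.sqrt t : ℝ) : ℂ) * ((1 / Real.sqrt t : ℝ) : ℂ))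
            - H h x) := by
  refine ⟨HalfHilbert.halfHilbert, HalfHilbert.ae_hasHalfHilbertAt, fun f => ⟨fun x hx =>
    HalfHilbert.integrableOn_log_mul f hx, ?_⟩, ?_⟩
  · filter_upwards [HalfHilbert.ae_hasDerivAt_integral_log f] with x hx
    refine ⟨_, hx, ?_⟩
    have hpi : (Real.pi : ℂ) ≠ 0 := by exact_mod_cast Real.pi_ne_zero
    push_cast
    field_simp
  · rintro f h rfl
    exact ⟨fun x hx => HalfHilbert.integrableOn_inversion _ hx, HalfHilbert.ae_inversion f⟩
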